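/- Let $q:\mathbb{R}\to\mathbb{R}$ be measurable with $\int_{-\infty}^{\infty}(1+|x|)\,|q(x)|\,dx<\infty$, let $q^-(x)=\max(-q(x),0)$, and let \[ \tau(q)=\max_{x_0\in\mathbb{R}}\min\left(\int_{-\infty}^{x_0}(x_0-x)\,q^-(x)\,dx,\ \int_{x_0}^{\infty}(x-x_0)\,q^-(x)\,dx\right) \] be Bargmann's integral. A bound state of \[ -v''+q(x)v=\lambda v \quad\text{on } \mathbb{R} \qquad (*) \] is a pair $(\lambda,v)$ of a real number $\lambda$ and a real-valued $v\in L^2(\mathbb{R})$, $v\not\equiv0$, such that $v$ is differentiable, $v'$ is locally absolutely continuous, and $(*)$ holds almost everywhere; bound states that differ by a nonzero scalar factor of $v$ are identified. Suppose that $\tau(q)<1$. Then $(*)$ has at most one bound state. If moreover $\int_{-\infty}^{\infty}q(x)\,dx<0$, then $(*)$ has exactly one bound state, and its eigenvalue $\lambda$ is negative. -/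

import Mathlib

open MeasureTheory Set

/-- Bargmann's integral
`τ(q) = sup_{x₀} min (∫_{-∞}^{x₀} (x₀ - x) q⁻(x) dx, ∫_{x₀}^{∞} (x - x₀) q⁻(x) dx)`,
where `q⁻ = max (-q, 0)`. Both integrands are nonnegative on their ranges, and the integrals are
taken in `[0, ∞]`. -/
noncomputable def bargmannTau (q : ℝ → ℝ) : ENNReal :=
  ⨆ x₀ : ℝ,
    min (∫⁻ x in Iic x₀, ENNReal.ofReal ((x₀ - x) * max (-q x) 0))
      (∫⁻ x in Ici x₀, ENNReal.ofReal ((x - x₀) * max (-q x) 0))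

/-- `v` is a bound state, with energy `E`, of `-v'' + q v = E v` on the line: a nonzero
square-integrable solution, `v` being differentiable with locally absolutely continuous
derivative and the equation holding almost everywhere. -/
structure IsBoundState (q : ℝ → ℝ) (E : ℝ) (v : ℝ → ℝ) : Prop where
  ne_zero : v ≠ 0
  memLp : MemLp v 2 volume
  differentiable : Differentiable ℝ v
  absCont : ∀ a b : ℝ, AbsolutelyContinuousOnInterval (deriv v) a b
  equation : ∀ᵐ x : ℝ, -deriv (deriv v) x + q x * v x = E * v x

/-- Bound states are counted with multiplicity, that is, up to a scalar factor within one
energy: any two bound states have the same energy and are proportional. -/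
def HasAtMostOneBoundState (q : ℝ → ℝ) : Prop :=
  ∀ (E F : ℝ) (v w : ℝ → ℝ), IsBoundState q E v → IsBoundState q F w →
    F = E ∧ ∃ c : ℝ, w = c • v

/-- There is a bound state with negative energy, and every bound state (with whatever real
energy) has the same energy and is proportional to it. -/
def HasExactlyOneBoundState (q : ℝ → ℝ) : Prop :=
  ∃ (E : ℝ) (v : ℝ → ℝ), E < 0 ∧ IsBoundState q E v ∧
    ∀ (F : ℝ) (w : ℝ → ℝ), IsBoundState q F w → F = E ∧ ∃ c : ℝ, w = c • v

open Filter Topology intervalIntegral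

/-! Uniqueness rests on the absence of zeros. If `u` has energy `E ≤ 0` and vanishes at `a`,
Cauchy–Schwarz gives `u(x)² ≤ (x - a) ∫ₐᴿ u'²` on `[a, R]`. Integrating `(u u')' = u'² + (q - E) u²`
then yields `(1 - m) ∫ₐᴿ u'² ≤ u(R) u'(R)` with `m = ∫ₐ^∞ (x - a) q⁻`. When `m < 1`, square
integrability forces `u = 0` (`eq_zero_of_bargmann`). As `τ(q) < 1` makes one of the two half-line
integrals smaller than `1` at every point, a bound state has no zero; positive energies are excluded
by `energy_nonpos`. Two nodeless bound states share their energy by a Wronskian argument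
(`not_energy_lt`), and are proportional because a combination of them vanishing at a point must be
zero.

For existence, take the Jost solutions of energy `-k²` decaying at `+∞` and at `-∞`; a bound state
is a zero in `k` of their Wronskian. By connectedness of the line there is a point `a` at which both
half-line integrals are below `1`, so neither Jost solution vanishes at `a` for any `k`. A Riccati
comparison bounds their logarithmic derivatives at `a` through `2k + ∫ e^{-2k|x-a|} q`, which tends
to `∫ q < 0` as `k → 0⁺`. This fixes the sign of the Wronskian at some small `ε`; the sign is
opposite for large `k`, and the intermediate value theorem applies on a range bounded away from `k =
0`. -/

/-- Absolute continuity on every compact interval. -/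
def LocallyAC (F : ℝ → ℝ) : Prop := ∀ a b : ℝ, AbsolutelyContinuousOnInterval F a b

/-! ### Calculus of locally absolutely continuous functions -/

namespace LocallyAC

variable {F G : ℝ → ℝ}

theorem continuous (hF : LocallyAC F) : Continuous F := by
  refine continuous_iff_continuousAt.2 fun x => ?_
  refine (hF (x - 1) (x + 1)).continuousOn.continuousAt ?_
  rw [uIcc_of_le (by linarith)]
  exact Icc_mem_nhds (by linarith) (by linarith)

theorem add (hF : LocallyAC F) (hG : LocallyAC G) : LocallyAC fun x => F x + G x :=
  fun a b => (hF a b).add (hG a b)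

theorem sub (hF : LocallyAC F) (hG : LocallyAC G) : LocallyAC fun x => F x - G x :=
  fun a b => (hF a b).sub (hG a b)

theorem neg (hF : LocallyAC F) : LocallyAC fun x => -F x :=
  fun a b => (hF a b).neg

theorem mul (hF : LocallyAC F) (hG : LocallyAC G) : LocallyAC fun x => F x * G x :=
  fun a b => (hF a b).mul (hG a b)

theorem const_mul (c : ℝ) (hF : LocallyAC F) : LocallyAC fun x => c * F x :=
  fun a b => (hF a b).const_mul c

theorem of_contDiff (hF : ContDiff ℝ 1 F) : LocallyAC F :=
  fun _ _ => hF.contDiffOn.absolutelyContinuousOnInterval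

theorem of_hasDerivAt (h : ∀ x, HasDerivAt F (G x) x) (hG : Continuous G) : LocallyAC F := by
  refine of_contDiff (contDiff_one_iff_deriv.2 ⟨fun x => (h x).differentiableAt, ?_⟩)
  rwa [show deriv F = G from funext fun x => (h x).deriv]

/-- `F` is bounded on a compact interval, and `exp` is Lipschitz on `(-∞, C]` with constant `e^C`.
-/
theorem exp (hF : LocallyAC F) : LocallyAC fun x => Real.exp (F x) := by
  intro a b
  obtain ⟨C, hC⟩ := (hF a b).exists_bound
  have hlip : LipschitzOnWith (Real.toNNReal (Real.exp C)) Real.exp (Iic C) := by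
    refine Convex.lipschitzOnWith_of_nnnorm_deriv_le (fun x _ => Real.differentiableAt_exp)
      (fun x hx => ?_) (convex_Iic C)
    rw [← NNReal.coe_le_coe, Real.coe_toNNReal _ (Real.exp_pos C).le, coe_nnnorm, Real.deriv_exp,
      Real.norm_of_nonneg (Real.exp_pos x).le]
    exact Real.exp_le_exp.2 hx
  have hmem : ∀ x ∈ uIcc a b, F x ∈ Iic C := fun x hx =>
    (le_abs_self _).trans (by simpa using hC x hx)
  have hF' := (absolutelyContinuousOnInterval_iff F a b).1 (hF a b)
  refine (absolutelyContinuousOnInterval_iff _ a b).2 fun ε hε => ?_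
  obtain ⟨δ, hδ, h⟩ := hF' (ε / Real.exp C) (by positivity)
  refine ⟨δ, hδ, fun E hE hEδ => ?_⟩
  have hlt := h E hE hEδ
  calc ∑ i ∈ Finset.range E.1, dist (Real.exp (F (E.2 i).1)) (Real.exp (F (E.2 i).2))
      ≤ ∑ i ∈ Finset.range E.1, Real.exp C * dist (F (E.2 i).1) (F (E.2 i).2) := by
        refine Finset.sum_le_sum fun i hi => ?_
        have := hlip.dist_le_mul _ (hmem _ (hE.1 i hi).1) _ (hmem _ (hE.1 i hi).2)
        rwa [Real.coe_toNNReal _ (Real.exp_pos C).le] at this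
    _ = Real.exp C * ∑ i ∈ Finset.range E.1, dist (F (E.2 i).1) (F (E.2 i).2) := by
        rw [Finset.mul_sum]
    _ < ε := by rwa [lt_div_iff₀' (Real.exp_pos C)] at hlt

theorem ae_hasDerivAt (hF : LocallyAC F) : ∀ᵐ x, HasDerivAt F (deriv F x) x := by
  have h : ∀ᵐ x, ∀ n : ℕ, x ∈ uIcc (-(n : ℝ)) n → DifferentiableAt ℝ F x :=
    ae_all_iff.2 fun n => (hF _ _).ae_differentiableAt
  filter_upwards [h] with x hx
  obtain ⟨n, hn⟩ := exists_nat_ge |x|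
  refine (hx n ?_).hasDerivAt
  rw [uIcc_of_le (by linarith [abs_nonneg x])]
  exact abs_le.1 hn

theorem integral_eq (hF : LocallyAC F) (hd : ∀ᵐ x, HasDerivAt F (G x) x) (a b : ℝ) :
    ∫ x in a..b, G x = F b - F a := by
  rw [← (hF a b).integral_deriv_eq_sub]
  exact integral_congr_ae (hd.mono fun _ hx _ => hx.deriv.symm)

/-- If `F' ≤ g` almost everywhere on `[a, b]`, then `F b - F a ≤ ∫ g`. -/
theorem _root_.AbsolutelyContinuousOnInterval.sub_le_integral {a b : ℝ}
    (hF : AbsolutelyContinuousOnInterval F a b) (hab : a ≤ b) {g : ℝ → ℝ}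
    (hg : IntervalIntegrable g volume a b)
    (hd : ∀ᵐ x, x ∈ Icc a b → ∃ d ≤ g x, HasDerivAt F d x) : F b - F a ≤ ∫ x in a..b, g x := by
  rw [← hF.integral_deriv_eq_sub]
  refine integral_mono_ae_restrict hab hF.intervalIntegrable_deriv hg ?_
  refine (ae_restrict_iff' measurableSet_Icc).2 (hd.mono fun x hx hxI => ?_)
  obtain ⟨d, hdg, hFd⟩ := hx hxI
  rwa [hFd.deriv]

theorem sub_le_integral (hF : LocallyAC F) {a b : ℝ} (hab : a ≤ b)
    {g : ℝ → ℝ} (hg : IntervalIntegrable g volume a b)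
    (hd : ∀ᵐ x, x ∈ Icc a b → ∃ d ≤ g x, HasDerivAt F d x) : F b - F a ≤ ∫ x in a..b, g x :=
  (hF a b).sub_le_integral hab hg hd

theorem integral_le_sub (hF : LocallyAC F) {a b : ℝ} (hab : a ≤ b)
    {g : ℝ → ℝ} (hg : IntervalIntegrable g volume a b)
    (hd : ∀ᵐ x, x ∈ Icc a b → ∃ d, g x ≤ d ∧ HasDerivAt F d x) :
    ∫ x in a..b, g x ≤ F b - F a := by
  rw [← (hF a b).integral_deriv_eq_sub]
  refine integral_mono_ae_restrict hab hg (hF a b).intervalIntegrable_deriv ?_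
  refine (ae_restrict_iff' measurableSet_Icc).2 (hd.mono fun x hx hxI => ?_)
  obtain ⟨d, hdg, hFd⟩ := hx hxI
  rwa [hFd.deriv]

theorem le_of_deriv_nonneg (hF : LocallyAC F) {a b : ℝ} (hab : a ≤ b)
    (hd : ∀ᵐ x, x ∈ Icc a b → ∃ d, 0 ≤ d ∧ HasDerivAt F d x) : F a ≤ F b := by
  have := hF.integral_le_sub (g := fun _ => 0) hab (by simp) hd
  simpa using this

theorem le_of_deriv_nonpos (hF : LocallyAC F) {a b : ℝ} (hab : a ≤ b)
    (hd : ∀ᵐ x, x ∈ Icc a b → ∃ d ≤ 0, HasDerivAt F d x) : F b ≤ F a := by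
  have := hF.sub_le_integral (g := fun _ => 0) hab (by simp) hd
  simpa using this

theorem of_integral {g : ℝ → ℝ} (hg : ∀ a b : ℝ, IntervalIntegrable g volume a b) (c : ℝ) :
    LocallyAC fun x => ∫ t in c..x, g t := by
  intro a b
  have h : min a (min b c) ≤ max a (max b c) := (min_le_left _ _).trans (le_max_left _ _)
  refine ((hg (min a (min b c)) (max a (max b c))).absolutelyContinuousOnInterval_intervalIntegral
    (c := c) ?_).mono (uIcc_subset_uIcc ?_ ?_)
  all_goals
    rw [uIcc_of_le h]
    constructor <;> simp

theorem ae_hasDerivAt_integral {g : ℝ → ℝ} (hg : ∀ a b : ℝ, IntervalIntegrable g volume a b)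
    (c : ℝ) : ∀ᵐ x, HasDerivAt (fun x => ∫ t in c..x, g t) (g x) x := by
  have h : ∀ᵐ x, ∀ n : ℕ, x ∈ uIcc (-(n : ℝ)) n → ∀ c ∈ uIcc (-(n : ℝ)) n,
      HasDerivAt (fun x => ∫ t in c..x, g t) (g x) x :=
    ae_all_iff.2 fun n => (hg _ _).ae_hasDerivAt_integral
  filter_upwards [h] with x hx
  obtain ⟨n, hn⟩ := exists_nat_ge (max |x| |c|)
  have h0 : (0 : ℝ) ≤ n := Nat.cast_nonneg n
  refine hx n ?_ c ?_ <;> rw [uIcc_of_le (by linarith)]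
  · exact abs_le.1 ((le_max_left _ _).trans hn)
  · exact abs_le.1 ((le_max_right _ _).trans hn)

theorem of_sub_eq_integral {g : ℝ → ℝ} (hg : ∀ a b : ℝ, IntervalIntegrable g volume a b)
    (h : ∀ x, F x - F 0 = ∫ t in (0 : ℝ)..x, g t) : LocallyAC F := by
  have hF : F = fun x => F 0 + ∫ t in (0 : ℝ)..x, g t := funext fun x => by rw [← h x]; ring
  rw [hF]
  exact (of_contDiff contDiff_const).add (of_integral hg 0)

theorem comp_neg (hF : LocallyAC F) : LocallyAC fun x => F (-x) := by
  have hi : ∀ a b : ℝ, IntervalIntegrable (fun x => -deriv F (-x)) volume a b := fun a b => by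
    simpa using! ((hF (-a) (-b)).intervalIntegrable_deriv.comp_sub_left 0).neg
  refine of_sub_eq_integral hi fun x => ?_
  rw [intervalIntegral.integral_neg, integral_comp_neg (deriv F), ← integral_symm,
    (hF _ _).integral_deriv_eq_sub]

/-- `F` is the integral of the continuous function `G`, so the exceptional null set disappears. -/
theorem hasDerivAt_of_ae (hF : LocallyAC F) (hd : ∀ᵐ x, HasDerivAt F (G x) x) (hG : Continuous G)
    (x : ℝ) : HasDerivAt F (G x) x := by
  have h : F = fun x => F 0 + ∫ t in (0 : ℝ)..x, G t :=
    funext fun x => by rw [hF.integral_eq hd]; ring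
  rw [h]
  exact (hG.integral_hasStrictDerivAt 0 x).hasDerivAt.const_add _

end LocallyAC

/-! ### Growth at infinity and Grönwall's inequality -/

/-- If `f' ≥ c > 0` beyond some point then `f` tends to infinity. -/
theorem tendsto_atTop_of_deriv_ge {f f' : ℝ → ℝ} {c a : ℝ} (hc : 0 < c)
    (hf : ∀ x, HasDerivAt f (f' x) x) (h : ∀ x ≥ a, c ≤ f' x) : Tendsto f atTop atTop := by
  have hlin : ∀ x ≥ a, f a + c * (x - a) ≤ f x := fun x hx => by
    have := Convex.mul_sub_le_image_sub_of_le_deriv (convex_Ici a)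
      (fun x _ => (hf x).continuousAt.continuousWithinAt)
      (fun x _ => (hf x).differentiableAt.differentiableWithinAt) (C := c)
      (fun x hx => by rw [(hf x).deriv]; exact h x (interior_subset hx)) a self_mem_Ici x hx hx
    linarith
  refine tendsto_atTop_mono' atTop (eventually_ge_atTop a |>.mono fun x hx => hlin x hx) ?_
  exact tendsto_atTop_add_const_left _ _
    ((tendsto_atTop_add_const_right _ (-a) tendsto_id).const_mul_atTop hc)

theorem not_tendsto_atTop_of_integrableOn {f : ℝ → ℝ} {a : ℝ} (hf : IntegrableOn f (Ici a)) :
    ¬ Tendsto f atTop atTop := by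
  intro h
  obtain ⟨b, hb⟩ := eventually_atTop.1 (h.eventually_ge_atTop 1)
  have hs : Ici (max a b) ⊆ Ici a := Ici_subset_Ici.2 (le_max_left _ _)
  have h1 : IntegrableOn (fun _ : ℝ => (1 : ℝ)) (Ici (max a b)) := by
    refine Integrable.mono' (hf.mono_set hs) aestronglyMeasurable_const ?_
    refine (ae_restrict_iff' measurableSet_Ici).2 (ae_of_all _ fun x hx => ?_)
    simpa using hb x ((le_max_right _ _).trans hx)
  rw [integrableOn_const_iff] at h1
  simp at h1

/-- **Grönwall's inequality** for a nonnegative absolutely continuous function, with an integrable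
rate that has the absolutely continuous primitive `K`. -/
theorem gronwall_mul_exp {W K : ℝ → ℝ} (hW : LocallyAC W) (hK : LocallyAC K)
    (h : ∀ᵐ x, ∃ w κ, HasDerivAt W w x ∧ HasDerivAt K κ x ∧ |w| ≤ κ * W x) {a b : ℝ}
    (hab : a ≤ b) :
    W b * Real.exp (-K b) ≤ W a * Real.exp (-K a) ∧ W a * Real.exp (K a) ≤ W b * Real.exp (K b) := by
  constructor
  · refine (hW.mul hK.neg.exp).le_of_deriv_nonpos hab (h.mono fun x hx _ => ?_)
    obtain ⟨w, κ, hw, hκ, hle⟩ := hx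
    refine ⟨_, ?_, hw.mul hκ.neg.exp⟩
    have := (abs_le.1 hle).2
    rw [Pi.neg_apply]
    nlinarith [Real.exp_pos (-K x)]
  · refine (hW.mul hK.exp).le_of_deriv_nonneg hab (h.mono fun x hx _ => ?_)
    obtain ⟨w, κ, hw, hκ, hle⟩ := hx
    refine ⟨_, ?_, hw.mul hκ.exp⟩
    have := (abs_le.1 hle).1
    nlinarith [Real.exp_pos (K x)]

theorem eq_zero_of_gronwall {W K : ℝ → ℝ} (hW : LocallyAC W) (hK : LocallyAC K)
    (h : ∀ᵐ x, ∃ w κ, HasDerivAt W w x ∧ HasDerivAt K κ x ∧ |w| ≤ κ * W x) (h0 : ∀ x, 0 ≤ W x)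
    {a : ℝ} (ha : W a = 0) (x : ℝ) : W x = 0 := by
  refine le_antisymm ?_ (h0 x)
  rcases le_total a x with hx | hx
  · have := (gronwall_mul_exp hW hK h hx).1
    rw [ha, zero_mul] at this
    exact nonpos_of_mul_nonpos_left this (Real.exp_pos _)
  · have := (gronwall_mul_exp hW hK h hx).2
    rw [ha, zero_mul] at this
    exact nonpos_of_mul_nonpos_left this (Real.exp_pos _)

/-! ### Carathéodory solutions and Bargmann's inequality -/

/-- `u` solves `-u'' + q u = E u` on the line, in the Carathéodory sense. -/
structure IsSolution (q : ℝ → ℝ) (E : ℝ) (u : ℝ → ℝ) : Prop where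
  differentiable : Differentiable ℝ u
  absCont : LocallyAC (deriv u)
  equation : ∀ᵐ x : ℝ, HasDerivAt (deriv u) ((q x - E) * u x) x

theorem IsBoundState.isSolution {q : ℝ → ℝ} {E : ℝ} {u : ℝ → ℝ} (h : IsBoundState q E u) :
    IsSolution q E u where
  differentiable := h.differentiable
  absCont := h.absCont
  equation := by
    filter_upwards [LocallyAC.ae_hasDerivAt h.absCont, h.equation] with x hx he
    rwa [show (q x - E) * u x = deriv (deriv u) x by linarith]

theorem IsBoundState.integrable_sq {q : ℝ → ℝ} {E : ℝ} {u : ℝ → ℝ} (h : IsBoundState q E u) :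
    Integrable fun x => u x ^ 2 :=
  h.memLp.integrable_sq

namespace IsSolution

variable {q : ℝ → ℝ} {E F : ℝ} {u w : ℝ → ℝ}

theorem hasDerivAt (hu : IsSolution q E u) (x : ℝ) : HasDerivAt u (deriv u x) x :=
  (hu.differentiable x).hasDerivAt

theorem locallyAC (hu : IsSolution q E u) : LocallyAC u :=
  LocallyAC.of_hasDerivAt hu.hasDerivAt hu.absCont.continuous

theorem of_hasDerivAt {u' : ℝ → ℝ} (h : ∀ x, HasDerivAt u (u' x) x) (hu' : LocallyAC u')
    (he : ∀ᵐ x, HasDerivAt u' ((q x - E) * u x) x) : IsSolution q E u := by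
  have hd : deriv u = u' := funext fun x => (h x).deriv
  exact ⟨fun x => (h x).differentiableAt, hd ▸ hu', hd ▸ he⟩

theorem linear_comb (hu : IsSolution q E u) (hw : IsSolution q E w) (a b : ℝ) :
    IsSolution q E fun x => a * u x + b * w x := by
  refine of_hasDerivAt (fun x => ((hu.hasDerivAt x).const_mul a).add ((hw.hasDerivAt x).const_mul b))
    ((hu.absCont.const_mul a).add (hw.absCont.const_mul b)) ?_
  filter_upwards [hu.equation, hw.equation] with x hux hwx
  exact ((hux.const_mul a).add (hwx.const_mul b)).congr_deriv (by ring)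

theorem const_mul (hu : IsSolution q E u) (a : ℝ) : IsSolution q E fun x => a * u x := by
  simpa using hu.linear_comb hu a 0

theorem deriv_comp_neg (hu : IsSolution q E u) (x : ℝ) :
    HasDerivAt (fun x => u (-x)) (-deriv u (-x)) x := by
  simpa using! (hu.hasDerivAt (-x)).comp x (hasDerivAt_neg x)

theorem comp_neg (hu : IsSolution q E u) : IsSolution (fun x => q (-x)) E fun x => u (-x) := by
  refine of_hasDerivAt hu.deriv_comp_neg hu.absCont.comp_neg.neg ?_
  filter_upwards [(quasiMeasurePreserving_neg (volume : Measure ℝ)).ae hu.equation] with x hx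
  simpa using! (hx.comp x (hasDerivAt_neg x)).neg

theorem hasDerivAt_sq (hu : IsSolution q E u) (x : ℝ) :
    HasDerivAt (fun x => u x ^ 2) (2 * (u x * deriv u x)) x :=
  ((hu.hasDerivAt x).pow 2).congr_deriv (by simp; ring)

theorem ae_hasDerivAt_mul_deriv (hu : IsSolution q E u) :
    ∀ᵐ x, HasDerivAt (fun x => u x * deriv u x) (deriv u x ^ 2 + (q x - E) * u x ^ 2) x := by
  filter_upwards [hu.equation] with x hx
  exact ((hu.hasDerivAt x).mul hx).congr_deriv (by ring)

/-- A solution that is square-integrable at infinity cannot have `u u'` bounded below by a positive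
constant there. -/
theorem not_le_mul_deriv (hu : IsSolution q E u) {a b c : ℝ} (hc : 0 < c)
    (hL : IntegrableOn (fun x => u x ^ 2) (Ici a)) : ¬ ∀ x ≥ b, c ≤ u x * deriv u x := fun h =>
  not_tendsto_atTop_of_integrableOn hL <|
    tendsto_atTop_of_deriv_ge (c := 2 * c) (by linarith) hu.hasDerivAt_sq fun x hx => by
      linarith [h x hx]

/-- Grönwall for `W = u² + u'²`: here `W' = 2 (1 + q - E) u u'` and `2 |u u'| ≤ W`, so the rate is
`1 + |E| + |q|`. -/
theorem eq_zero_of_initial (hu : IsSolution q E u) (hq : Integrable q) {a : ℝ} (h0 : u a = 0)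
    (h1 : deriv u a = 0) (x : ℝ) : u x = 0 := by
  have hκ : ∀ a b : ℝ, IntervalIntegrable (fun x => 1 + |E| + |q x|) volume a b := fun a b =>
    intervalIntegrable_const.add hq.abs.intervalIntegrable
  have hW : LocallyAC fun x => u x * u x + deriv u x * deriv u x :=
    (hu.locallyAC.mul hu.locallyAC).add (hu.absCont.mul hu.absCont)
  have := eq_zero_of_gronwall hW (LocallyAC.of_integral hκ 0) ?_
    (fun x => add_nonneg (mul_self_nonneg _) (mul_self_nonneg _)) (a := a) (by simp [h0, h1]) x
  · nlinarith [mul_self_nonneg (deriv u x), mul_self_nonneg (u x)]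
  filter_upwards [hu.equation, LocallyAC.ae_hasDerivAt_integral hκ 0] with x hx hK
  refine ⟨_, _, ((hu.hasDerivAt x).mul (hu.hasDerivAt x)).add (hx.mul hx), hK, ?_⟩
  have h2 : |u x * deriv u x| * 2 ≤ u x * u x + deriv u x * deriv u x := by
    rw [abs_mul]
    nlinarith [sq_nonneg (|u x| - |deriv u x|), abs_mul_abs_self (u x),
      abs_mul_abs_self (deriv u x)]
  have h3 : |1 + (q x - E)| ≤ 1 + |E| + |q x| := by
    refine (abs_add_le _ _).trans ?_
    rw [abs_one]
    linarith [abs_sub (q x) E]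
  calc _ = |1 + (q x - E)| * (|u x * deriv u x| * 2) := by
        rw [show (2 : ℝ) = |2| by simp, ← abs_mul, ← abs_mul]
        congr 1
        ring
    _ ≤ _ := mul_le_mul h3 h2 (by positivity) (by positivity)

/-- Cauchy–Schwarz for `u(x) = ∫ₐˣ u'`, obtained by expanding `∫ (u' - c)² ≥ 0` with `c` the mean
slope. -/
theorem sq_le_mul_integral (hu : IsSolution q E u) {a x : ℝ} (hax : a ≤ x) (h0 : u a = 0) :
    u x ^ 2 ≤ (x - a) * ∫ t in a..x, deriv u t ^ 2 := by
  rcases hax.eq_or_lt with rfl | hlt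
  · simp [h0]
  have hc := hu.absCont.continuous
  set c := u x / (x - a) with hcdef
  have hcx : c * (x - a) = u x := div_mul_cancel₀ _ (by linarith)
  have h1 : ∫ t in a..x, deriv u t = u x := by
    rw [hu.locallyAC.integral_eq (ae_of_all _ hu.hasDerivAt), h0, sub_zero]
  have h2 : 0 ≤ ∫ t in a..x, (deriv u t - c) ^ 2 := integral_nonneg hax fun t _ => sq_nonneg _
  have h3 : ∫ t in a..x, (deriv u t - c) ^ 2
      = (∫ t in a..x, deriv u t ^ 2) - 2 * c * u x + c ^ 2 * (x - a) := by
    have hk : ∫ _ in a..x, c ^ 2 = c ^ 2 * (x - a) := by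
      rw [intervalIntegral.integral_const, smul_eq_mul, mul_comm]
    rw [← h1, ← hk, ← intervalIntegral.integral_const_mul, ← intervalIntegral.integral_sub,
      ← intervalIntegral.integral_add]
    · congr 1; ext t; ring
    all_goals exact Continuous.intervalIntegrable (by fun_prop) _ _
  have h4 : 0 ≤ (x - a) * ((∫ t in a..x, deriv u t ^ 2) - 2 * c * u x + c ^ 2 * (x - a)) :=
    mul_nonneg (by linarith) (h3 ▸ h2)
  rw [← hcx] at h4 ⊢
  nlinarith

theorem eq_zero_of_eq_zero_Ici (hu : IsSolution q E u) (hq : Integrable q) {a : ℝ}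
    (h : ∀ x ≥ a, u x = 0) (x : ℝ) : u x = 0 := by
  refine hu.eq_zero_of_initial hq (h (a + 1) (by linarith)) ?_ x
  have : u =ᶠ[𝓝 (a + 1)] fun _ => 0 :=
    (eventually_ge_nhds (show a < a + 1 by linarith)).mono h
  rw [this.deriv_eq, deriv_const]

/-- **Bargmann's inequality**: a solution of nonpositive energy which vanishes at `a` and is square
integrable at infinity is zero if `∫ₐ^∞ (x - a) q⁻ < 1`. -/
theorem eq_zero_of_bargmann (hu : IsSolution q E u) (hq : Integrable q) (hE : E ≤ 0) {a : ℝ}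
    (h0 : u a = 0) (hL : IntegrableOn (fun x => u x ^ 2) (Ici a))
    (hm : ∫⁻ x in Ici a, ENNReal.ofReal ((x - a) * max (-q x) 0) < 1) (x : ℝ) : u x = 0 := by
  set φ : ℝ → ℝ := fun x => (x - a) * max (-q x) 0 with hφ
  have hφ0 : ∀ x ∈ Ici a, 0 ≤ φ x := fun x hx =>
    mul_nonneg (sub_nonneg.2 hx) (le_max_right _ _)
  have hφ0' : 0 ≤ᵐ[volume.restrict (Ici a)] φ :=
    (ae_restrict_iff' measurableSet_Ici).2 (ae_of_all _ hφ0)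
  have hφm : AEStronglyMeasurable φ (volume.restrict (Ici a)) :=
    (by fun_prop : Continuous fun x : ℝ => x - a).aestronglyMeasurable.mul
      (hq.neg.pos_part.aestronglyMeasurable.restrict)
  have hφi : IntegrableOn φ (Ici a) :=
    (lintegral_ofReal_ne_top_iff_integrable hφm hφ0').1 (hm.trans ENNReal.one_lt_top).ne
  set m := ∫ x in Ici a, φ x with hmdef
  have hm1 : m < 1 := by
    rw [hmdef, integral_eq_lintegral_of_nonneg_ae hφ0' hφm]
    exact (ENNReal.toReal_lt_toReal (hm.trans ENNReal.one_lt_top).ne ENNReal.one_ne_top).2 hm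
  have hφint : ∀ R, a ≤ R → IntervalIntegrable φ volume a R := fun R hR =>
    (intervalIntegrable_iff_integrableOn_Ioc_of_le hR).2
      (hφi.mono_set (Ioc_subset_Icc_self.trans Icc_subset_Ici_self))
  have hφle : ∀ R, a ≤ R → ∫ x in a..R, φ x ≤ m := fun R hR => by
    rw [integral_of_le hR]
    exact setIntegral_mono_set hφi hφ0'
      (Ioc_subset_Icc_self.trans Icc_subset_Ici_self).eventuallyLE
  have hc := hu.absCont.continuous
  have hci : ∀ a b : ℝ, IntervalIntegrable (fun t => deriv u t ^ 2) volume a b := fun a b =>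
    Continuous.intervalIntegrable (by fun_prop) _ _
  set G : ℝ → ℝ := fun R => ∫ t in a..R, deriv u t ^ 2 with hG
  have hGmono : ∀ x R, a ≤ x → x ≤ R → G x ≤ G R := fun x R hx hR =>
    integral_mono_interval le_rfl hx hR (ae_of_all _ fun t => sq_nonneg _) (hci _ _)
  have hG0 : ∀ x ≥ a, 0 ≤ G x := fun x hx => integral_nonneg hx fun t _ => sq_nonneg _
  -- Integrate `(u u')' ≥ u'² - q⁻ u²`, which uses `E ≤ 0`, and bound `u²` by `(x - a) G(R)`; the
  -- loss is at most `m G(R)`.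
  have key : ∀ R ≥ a, (1 - m) * G R ≤ u R * deriv u R := fun R hR => by
    have h1 := (hu.locallyAC.mul hu.absCont).integral_le_sub hR
      (g := fun x => deriv u x ^ 2 - φ x * G R) ((hci _ _).sub ((hφint R hR).mul_const _)) ?_
    · rw [intervalIntegral.integral_sub (hci _ _) ((hφint R hR).mul_const _), intervalIntegral.integral_mul_const,
        h0, zero_mul, sub_zero] at h1
      have := mul_le_mul_of_nonneg_right (hφle R hR) (hG0 R hR)
      have : G R - (∫ x in a..R, φ x) * G R ≤ u R * deriv u R := h1
      linarith
    · filter_upwards [hu.ae_hasDerivAt_mul_deriv] with x hx hxI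
      refine ⟨_, ?_, hx⟩
      have h2 : u x ^ 2 ≤ (x - a) * G R := (hu.sq_le_mul_integral hxI.1 h0).trans
        (mul_le_mul_of_nonneg_left (hGmono x R hxI.1 hxI.2) (sub_nonneg.2 hxI.1))
      have h3 : max (-q x) 0 * u x ^ 2 ≤ max (-q x) 0 * ((x - a) * G R) :=
        mul_le_mul_of_nonneg_left h2 (le_max_right _ _)
      have h4 : -(max (-q x) 0) * u x ^ 2 ≤ (q x - E) * u x ^ 2 :=
        mul_le_mul_of_nonneg_right (by linarith [le_max_left (-q x) 0]) (sq_nonneg _)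
      simp only [hφ]
      linarith
  refine hu.eq_zero_of_eq_zero_Ici hq (a := a) (fun R hR => ?_) x
  -- Otherwise `u u' ≥ (1 - m) G(R) > 0` on `[R, ∞)`, since `G` is monotone, and `u²` would grow
  -- linearly.
  have hGR : G R = 0 := by
    by_contra hne
    have hpos : 0 < G R := lt_of_le_of_ne (hG0 R hR) (Ne.symm hne)
    refine hu.not_le_mul_deriv (b := R) (c := (1 - m) * G R) (mul_pos (by linarith) hpos) hL
      fun y hy => ?_
    have : a ≤ y := le_trans hR hy
    exact (mul_le_mul_of_nonneg_left (hGmono R y hR hy) (by linarith)).trans (key y this)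
  have := hu.sq_le_mul_integral hR h0
  rw [show ∫ t in a..R, deriv u t ^ 2 = 0 from hGR, mul_zero] at this
  exact pow_eq_zero_iff two_ne_zero |>.1 (le_antisymm this (sq_nonneg _))

end IsSolution

/-! ### Reflection, absence of positive energies, comparison of energies -/

theorem setLIntegral_Iic_comp_neg (f : ℝ → ENNReal) (a : ℝ) :
    ∫⁻ x in Ici (-a), f (-x) = ∫⁻ x in Iic a, f x := by
  have := (Measure.measurePreserving_neg (volume : Measure ℝ)).setLIntegral_comp_preimage_emb
    (Homeomorph.neg ℝ).measurableEmbedding f (Iic a)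
  rw [← this]
  congr 2
  ext x
  simp

theorem integrableOn_Ici_comp_neg_iff {f : ℝ → ℝ} {a : ℝ} :
    IntegrableOn (fun x => f (-x)) (Ici (-a)) ↔ IntegrableOn f (Iic a) := by
  rw [← (Measure.measurePreserving_neg (volume : Measure ℝ)).integrableOn_comp_preimage (f := f)
    (Homeomorph.neg ℝ).measurableEmbedding,
    show Neg.neg ⁻¹' Iic a = Ici (-a) by ext x; simp]
  rfl

theorem setIntegral_le_integral_sq {v : ℝ → ℝ} (hv : Integrable fun x => v x ^ 2) {a b : ℝ}
    (hab : a ≤ b) : ∫ x in a..b, v x ^ 2 ≤ ∫ x, v x ^ 2 := by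
  rw [integral_of_le hab]
  exact setIntegral_le_integral hv (ae_of_all _ fun x => sq_nonneg _)

namespace IsSolution

variable {q : ℝ → ℝ} {E F : ℝ} {u v w : ℝ → ℝ}

theorem eq_zero_of_bargmann_left (hu : IsSolution q E u) (hq : Integrable q) (hE : E ≤ 0) {a : ℝ}
    (h0 : u a = 0) (hL : IntegrableOn (fun x => u x ^ 2) (Iic a))
    (hm : ∫⁻ x in Iic a, ENNReal.ofReal ((a - x) * max (-q x) 0) < 1) (x : ℝ) : u x = 0 := by
  have := hu.comp_neg.eq_zero_of_bargmann hq.comp_neg hE (a := -a) (by simpa using h0)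
    (integrableOn_Ici_comp_neg_iff.2 hL) ?_ (-x)
  · simpa using this
  rw [← setLIntegral_Iic_comp_neg] at hm
  refine lt_of_eq_of_lt ?_ hm
  congr 1
  ext t
  congr 2
  ring

/-- For `E > 0` the quantity `W = u'² + E u²` has `W' = 2 q u u'`, hence `|W'| ≤ (|q| / √E) W`. As
`q` is integrable, `W` stays between two positive constants on `[0, ∞)`. Then `(u u')' = W - 2 E u²
+ q u²`, where the last two terms have bounded integral, so `u u'` grows linearly, against square
integrability. -/
theorem energy_nonpos (hu : IsSolution q E u) (hq : Integrable q)
    (hL : Integrable fun x => u x ^ 2) (hne : u ≠ 0) : E ≤ 0 := by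
  by_contra! hE
  set s := √E with hs
  have hs0 : 0 < s := Real.sqrt_pos.2 hE
  have hsE : s * s = E := Real.mul_self_sqrt hE.le
  have hκ : ∀ a b : ℝ, IntervalIntegrable (fun x => |q x| / s) volume a b := fun a b =>
    (hq.abs.div_const s).intervalIntegrable
  set K : ℝ → ℝ := fun x => ∫ t in (0 : ℝ)..x, |q t| / s with hKdef
  have hK : LocallyAC K := LocallyAC.of_integral hκ 0
  set W : ℝ → ℝ := fun x => deriv u x * deriv u x + E * (u x * u x) with hWdef
  have hW : LocallyAC W :=
    (hu.absCont.mul hu.absCont).add ((hu.locallyAC.mul hu.locallyAC).const_mul E)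
  have hW0 : ∀ x, 0 ≤ W x := fun x =>
    add_nonneg (mul_self_nonneg _) (mul_nonneg hE.le (mul_self_nonneg _))
  have hWK : ∀ᵐ x, ∃ w κ, HasDerivAt W w x ∧ HasDerivAt K κ x ∧ |w| ≤ κ * W x := by
    filter_upwards [hu.equation, LocallyAC.ae_hasDerivAt_integral hκ 0] with x hx hKx
    refine ⟨_, _, (hx.mul hx).add (((hu.hasDerivAt x).mul (hu.hasDerivAt x)).const_mul E), hKx, ?_⟩
    have h2 : 2 * s * |u x * deriv u x| ≤ W x := by
      rw [abs_mul]
      have : 0 ≤ (s * |u x| - |deriv u x|) ^ 2 := sq_nonneg _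
      have e : (s * |u x| - |deriv u x|) ^ 2 = W x - 2 * s * (|u x| * |deriv u x|) := by
        simp only [hWdef]
        rw [← hsE, ← abs_mul_abs_self (u x), ← abs_mul_abs_self (deriv u x)]
        ring
      linarith
    calc _ = |q x| / s * (2 * s * |u x * deriv u x|) := by
          rw [show |q x| / s * (2 * s * |u x * deriv u x|) = |q x| * |u x * deriv u x| * |2| by
            rw [abs_two]; field_simp, ← abs_mul, ← abs_mul]
          congr 1
          ring
      _ ≤ _ := mul_le_mul_of_nonneg_left h2 (by positivity)
  have hWpos : 0 < W 0 := by
    refine lt_of_le_of_ne (hW0 0) fun h => hne (funext fun x => ?_)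
    have h1 := eq_zero_of_gronwall hW hK hWK hW0 h.symm x
    have h2 : E * (u x * u x) = 0 := by
      have := mul_nonneg hE.le (mul_self_nonneg (u x))
      have := mul_self_nonneg (deriv u x)
      simp only [hWdef] at h1
      linarith
    simpa [hE.ne'] using h2
  set M := ∫ t, |q t| / s with hM
  have hKM : ∀ x ≥ 0, K x ≤ M := fun x hx => by
    simp only [hKdef]
    rw [integral_of_le hx]
    exact setIntegral_le_integral (hq.abs.div_const s)
      (ae_of_all _ fun x => div_nonneg (abs_nonneg _) hs0.le)
  have hK0 : K 0 = 0 := by simp [hKdef]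
  set c := W 0 * Real.exp (-M) with hc
  set C := W 0 * Real.exp M with hC
  have hc0 : 0 < c := by positivity
  have hcW : ∀ x ≥ 0, c ≤ W x := fun x hx => by
    have h := (gronwall_mul_exp hW hK hWK hx).2
    rw [hK0, Real.exp_zero, mul_one] at h
    calc c ≤ W x * Real.exp (K x) * Real.exp (-M) :=
          mul_le_mul_of_nonneg_right h (Real.exp_pos _).le
      _ = W x * Real.exp (K x - M) := by rw [mul_assoc, ← Real.exp_add]; rfl
      _ ≤ W x * 1 := mul_le_mul_of_nonneg_left
          (Real.exp_le_one_iff.2 (by linarith [hKM x hx])) (hW0 x)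
      _ = W x := mul_one _
  have hWC : ∀ x ≥ 0, W x ≤ C := fun x hx => by
    have h := (gronwall_mul_exp hW hK hWK hx).1
    rw [hK0, neg_zero, Real.exp_zero, mul_one] at h
    calc W x = W x * Real.exp (-K x) * Real.exp (K x) := by
          rw [mul_assoc, ← Real.exp_add]; simp
      _ ≤ W 0 * Real.exp (K x) := mul_le_mul_of_nonneg_right h (Real.exp_pos _).le
      _ ≤ C := mul_le_mul_of_nonneg_left (Real.exp_le_exp.2 (hKM x hx)) (hW0 0)
  have hb : Integrable fun x => |q x| * (C / E) + 2 * E * u x ^ 2 :=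
    (hq.abs.mul_const _).add (hL.const_mul _)
  set B := ∫ x, (|q x| * (C / E) + 2 * E * u x ^ 2) with hB
  have hC0 : 0 ≤ C := by positivity
  have key : ∀ R ≥ 0, c * R - B ≤ u R * deriv u R - u 0 * deriv u 0 := fun R hR => by
    have h1 := (hu.locallyAC.mul hu.absCont).integral_le_sub hR
      (g := fun x => c - (|q x| * (C / E) + 2 * E * u x ^ 2))
      (intervalIntegrable_const.sub hb.intervalIntegrable) ?_
    · rw [intervalIntegral.integral_sub intervalIntegrable_const hb.intervalIntegrable,
        intervalIntegral.integral_const] at h1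
      have h2 : ∫ x in (0 : ℝ)..R, (|q x| * (C / E) + 2 * E * u x ^ 2) ≤ B := by
        rw [integral_of_le hR]
        exact setIntegral_le_integral hb (ae_of_all _ fun x => by
          simp only [Pi.zero_apply]; positivity)
      simp only [sub_zero, smul_eq_mul] at h1
      linarith
    · filter_upwards [hu.ae_hasDerivAt_mul_deriv] with x hx hxI
      refine ⟨_, ?_, hx⟩
      have h2 := hcW x hxI.1
      have h3 := hWC x hxI.1
      have h4 : u x ^ 2 ≤ C / E := by
        rw [le_div_iff₀ hE]
        have := mul_self_nonneg (deriv u x)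
        simp only [hWdef] at h3
        linarith
      have h5 : |q x| * u x ^ 2 ≤ |q x| * (C / E) := mul_le_mul_of_nonneg_left h4 (abs_nonneg _)
      have h6 : -|q x| * u x ^ 2 ≤ q x * u x ^ 2 :=
        mul_le_mul_of_nonneg_right (neg_abs_le _) (sq_nonneg _)
      simp only [hWdef] at h2
      linarith
  refine hu.not_le_mul_deriv (a := 0) (b := max 0 ((1 + B - u 0 * deriv u 0) / c)) one_pos
    hL.integrableOn fun x hx => ?_
  have h1 := key x ((le_max_left _ _).trans hx)
  have h2 := (div_le_iff₀' hc0).1 ((le_max_right _ _).trans hx)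
  linarith

/-- Positive square-integrable solutions have the same energy. -/
theorem not_energy_lt (hv : IsSolution q E v) (hw : IsSolution q F w)
    (hvL : Integrable fun x => v x ^ 2) (hv0 : ∀ x, 0 < v x) (hw0 : ∀ x, 0 < w x) : ¬ E < F := by
  intro hEF
  -- The Wronskian satisfies `N' = (E - F) v w < 0` and `(w / v)' = N / v²`. Being nonincreasing and
  -- not identically zero, `N` stays away from `0` on a half-line. There `w / v > 0` is
  -- contradicted, because `1 / v²` has infinite integral when `v²` is integrable.
  set N : ℝ → ℝ := fun x => deriv w x * v x - w x * deriv v x with hN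
  have hNac : LocallyAC N := (hw.absCont.mul hv.locallyAC).sub (hw.locallyAC.mul hv.absCont)
  have hNd : ∀ᵐ x, HasDerivAt N ((E - F) * (v x * w x)) x := by
    filter_upwards [hv.equation, hw.equation] with x hvx hwx
    exact ((hwx.mul (hv.hasDerivAt x)).sub ((hw.hasDerivAt x).mul hvx)).congr_deriv (by ring)
  have hanti : ∀ a b, a ≤ b → N b ≤ N a := fun a b hab =>
    hNac.le_of_deriv_nonpos hab <| hNd.mono fun x hx _ =>
      ⟨_, mul_nonpos_of_nonpos_of_nonneg (by linarith) (mul_pos (hv0 x) (hw0 x)).le, hx⟩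
  have hvc := hv.locallyAC.continuous
  have hwc := hw.locallyAC.continuous
  have hstrict : N 1 < N 0 := by
    have h1 := hNac.integral_eq hNd 0 1
    rw [intervalIntegral.integral_const_mul] at h1
    have h2 : 0 < ∫ x in (0 : ℝ)..1, v x * w x :=
      intervalIntegral_pos_of_pos (Continuous.intervalIntegrable (by fun_prop) _ _)
        (fun x => mul_pos (hv0 x) (hw0 x)) one_pos
    nlinarith
  set f : ℝ → ℝ := fun x => w x / v x with hf
  have hf0 : ∀ x, 0 < f x := fun x => div_pos (hw0 x) (hv0 x)
  have hfd : ∀ x, HasDerivAt f (N x / v x ^ 2) x := fun x =>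
    (hw.hasDerivAt x).div (hv.hasDerivAt x) (hv0 x).ne'
  have hfac : LocallyAC f := LocallyAC.of_hasDerivAt hfd
    (hNac.continuous.div (hvc.pow 2) fun x => (pow_pos (hv0 x) 2).ne')
  -- From `s + 1/s ≥ 2`: the integral of `1 / v²` over an interval of length `ℓ` is at least `2ℓ -
  -- I`.
  have hv2 : ∀ x, 2 - v x ^ 2 ≤ 1 / v x ^ 2 := fun x => by
    have := hv0 x
    rw [le_div_iff₀ (by positivity)]
    nlinarith [sq_nonneg (v x ^ 2 - 1)]
  set I := ∫ x, v x ^ 2 with hI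
  have hint : ∀ c a b : ℝ, a ≤ b → 0 ≤ c →
      c * (2 * (b - a) - I) ≤ ∫ x in a..b, c * (2 - v x ^ 2) := fun c a b hab hc => by
    rw [intervalIntegral.integral_const_mul, intervalIntegral.integral_sub intervalIntegrable_const
      hvL.intervalIntegrable, intervalIntegral.integral_const, smul_eq_mul, mul_comm (b - a)]
    exact mul_le_mul_of_nonneg_left (by linarith [setIntegral_le_integral_sq hvL hab]) hc
  have hgi : ∀ c a b : ℝ, IntervalIntegrable (fun x => c * (2 - v x ^ 2)) volume a b :=
    fun c a b => Continuous.intervalIntegrable (by fun_prop) _ _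
  have hcN : ∀ c x, 0 < c → c ≤ |N x| → c * (2 - v x ^ 2) ≤ |N x| / v x ^ 2 := fun c x hc h => by
    have h3 : (0 : ℝ) ≤ 1 / v x ^ 2 := by positivity
    calc c * (2 - v x ^ 2) ≤ c * (1 / v x ^ 2) := mul_le_mul_of_nonneg_left (hv2 x) hc.le
      _ ≤ |N x| * (1 / v x ^ 2) := mul_le_mul_of_nonneg_right h h3
      _ = |N x| / v x ^ 2 := by ring
  have hI0 : 0 ≤ I := integral_nonneg fun x => sq_nonneg _
  obtain ⟨a, ha⟩ : ∃ a, N a ≠ 0 := by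
    by_contra! h
    simp [h] at hstrict
  set c := |N a| with hc
  have hc0 : 0 < c := abs_pos.2 ha
  -- On an interval of this length `w / v` changes by at least `c (2d - I) = 2 f(a) + c I ≥ f(a)`.
  set d := (f a / c + I) with hd
  have hd0 : 0 ≤ d := add_nonneg (div_nonneg (hf0 a).le hc0.le) hI0
  have hcd : c * (2 * d - I) ≥ f a := by
    have : c * (f a / c) = f a := mul_div_cancel₀ _ hc0.ne'
    nlinarith [mul_nonneg hc0.le hd0]
  -- If `N(a) < 0`, move right from `a`; if `N(a) > 0`, move left. Either way `w / v` falls by at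
  -- least `f(a)`, to a value `≤ 0`.
  rcases ha.lt_or_gt with hneg | hpos
  · have h1 := hint c a (a + d) (by linarith) hc0.le
    have h2 := hfac.neg.integral_le_sub (by linarith) (hgi c a (a + d)) (ae_of_all _ fun x hx => ?_)
    · rw [show a + d - a = d by ring] at h1
      linarith [hf0 (a + d)]
    · have hNx := hanti a x hx.1
      refine ⟨_, ?_, (hfd x).neg⟩
      have := hcN c x hc0 (by
        rw [hc, abs_of_neg hneg, abs_of_neg (hNx.trans_lt hneg)]; linarith)
      rwa [abs_of_neg (hNx.trans_lt hneg), neg_div] at this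
  · have h1 := hint c (a - d) a (by linarith) hc0.le
    have h2 := hfac.integral_le_sub (by linarith) (hgi c (a - d) a) (ae_of_all _ fun x hx => ?_)
    · rw [show a - (a - d) = d by ring] at h1
      linarith [hf0 (a - d)]
    · have hNx := hanti x a hx.2
      refine ⟨_, ?_, hfd x⟩
      have := hcN c x hc0 (by
        rw [hc, abs_of_pos hpos, abs_of_pos (hpos.trans_le hNx)]; exact hNx)
      rwa [abs_of_pos (hpos.trans_le hNx)] at this

end IsSolution

/-! ### Uniqueness of the bound state -/

theorem IsBoundState.apply_ne_zero {q : ℝ → ℝ} {E : ℝ} {v : ℝ → ℝ} (hv : IsBoundState q E v)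
    (hq : Integrable q) (hτ : bargmannTau q < 1) (x : ℝ) : v x ≠ 0 := by
  intro h0
  have hE := hv.isSolution.energy_nonpos hq hv.integrable_sq hv.ne_zero
  have hmin := (le_iSup (fun x₀ : ℝ => min (∫⁻ x in Iic x₀, ENNReal.ofReal ((x₀ - x) * max (-q x) 0))
      (∫⁻ x in Ici x₀, ENNReal.ofReal ((x - x₀) * max (-q x) 0))) x).trans_lt hτ
  refine hv.ne_zero (funext fun y => ?_)
  rcases min_lt_iff.1 hmin with h | h
  · exact hv.isSolution.eq_zero_of_bargmann_left hq hE h0 hv.integrable_sq.integrableOn h y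
  · exact hv.isSolution.eq_zero_of_bargmann hq hE h0 hv.integrable_sq.integrableOn h y

theorem forall_pos_or_forall_neg {v : ℝ → ℝ} (hc : Continuous v) (h : ∀ x, v x ≠ 0) :
    (∀ x, 0 < v x) ∨ ∀ x, 0 < (-1) * v x := by
  by_contra! hcon
  obtain ⟨⟨a, ha⟩, b, hb⟩ := hcon
  obtain ⟨x, hx⟩ := mem_range_of_exists_le_of_exists_ge hc ⟨a, ha⟩ ⟨b, by linarith⟩
  exact h x hx

theorem IsBoundState.not_energy_lt {q : ℝ → ℝ} {E F : ℝ} {v w : ℝ → ℝ} (hv : IsBoundState q E v)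
    (hw : IsBoundState q F w) (hq : Integrable q) (hτ : bargmannTau q < 1) : ¬ E < F := by
  have hvs := hv.isSolution
  have hws := hw.isSolution
  have hvL : Integrable fun x => ((-1) * v x) ^ 2 := by simpa using hv.integrable_sq
  rcases forall_pos_or_forall_neg hvs.locallyAC.continuous (hv.apply_ne_zero hq hτ) with h | h <;>
  rcases forall_pos_or_forall_neg hws.locallyAC.continuous (hw.apply_ne_zero hq hτ) with h' | h'
  · exact hvs.not_energy_lt hws hv.integrable_sq h h'
  · exact hvs.not_energy_lt (hws.const_mul (-1)) hv.integrable_sq h h'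
  · exact (hvs.const_mul (-1)).not_energy_lt hws hvL h h'
  · exact (hvs.const_mul (-1)).not_energy_lt (hws.const_mul (-1)) hvL h h'

/-- Once the energies agree, `w - (w(0) / v(0)) v` vanishes at `0`; were it nonzero, it would be a
bound state with a zero. -/
theorem hasAtMostOneBoundState {q : ℝ → ℝ} (hq : Integrable q) (hτ : bargmannTau q < 1) :
    HasAtMostOneBoundState q := by
  intro E F v w hv hw
  obtain rfl : F = E :=
    le_antisymm (not_lt.1 (hv.not_energy_lt hw hq hτ)) (not_lt.1 (hw.not_energy_lt hv hq hτ))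
  refine ⟨rfl, w 0 / v 0, ?_⟩
  have hv0 := hv.apply_ne_zero hq hτ 0
  have hs := hw.isSolution.linear_comb hv.isSolution 1 (-(w 0 / v 0))
  have hL : MemLp (fun x => 1 * w x + -(w 0 / v 0) * v x) 2 volume :=
    (hw.memLp.const_mul 1).add (hv.memLp.const_mul _)
  have hz : (fun x => 1 * w x + -(w 0 / v 0) * v x) = 0 := by
    by_contra hne
    refine IsBoundState.apply_ne_zero (q := q) (E := F) ⟨hne, hL, hs.differentiable, hs.absCont, ?_⟩
      hq hτ 0 ?_
    · filter_upwards [hs.equation] with x hx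
      rw [hx.deriv]
      ring
    · field_simp
      ring
  funext x
  have := congrFun hz x
  simp only [Pi.zero_apply] at this
  simp only [Pi.smul_apply, smul_eq_mul]
  linarith

/-! ### Construction of the Jost solutions -/

/-- The kernel `(1 - e^{-2κs}) / (2κ)` for `s ≥ 0`, extended by zero. -/
noncomputable def jostKernel (κ s : ℝ) : ℝ := (1 - Real.exp (-(2 * κ * max s 0))) / (2 * κ)

theorem jostKernel_of_nonpos (κ : ℝ) {s : ℝ} (hs : s ≤ 0) : jostKernel κ s = 0 := by
  simp [jostKernel, max_eq_right hs]

theorem jostKernel_nonneg {κ : ℝ} (hκ : 0 < κ) (s : ℝ) : 0 ≤ jostKernel κ s := by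
  refine div_nonneg (sub_nonneg.2 (Real.exp_le_one_iff.2 ?_)) (by linarith)
  have := mul_nonneg hκ.le (le_max_right s 0)
  linarith

theorem jostKernel_le {κ : ℝ} (hκ : 0 < κ) (s : ℝ) : jostKernel κ s ≤ 1 / (2 * κ) :=
  div_le_div_of_nonneg_right (by linarith [Real.exp_pos (-(2 * κ * max s 0))]) (by linarith)

/-- The weight integral `∫ₓ^∞ |q| e^{-α(A - A(x))} ≤ 1 / α`, where `A' = |q|`. -/
theorem integral_abs_mul_exp_le {q A : ℝ → ℝ} (hq : Integrable q) (hA : LocallyAC A)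
    (hAd : ∀ᵐ x, HasDerivAt A (|q x|) x) (hmono : Monotone A) {α : ℝ} (hα : 0 < α) (x : ℝ) :
    IntegrableOn (fun t => |q t| * Real.exp (-(α * (A t - A x)))) (Ioi x) ∧
      ∫ t in Ioi x, |q t| * Real.exp (-(α * (A t - A x))) ≤ 1 / α := by
  have hAc := hA.continuous
  have hi : IntegrableOn (fun t => |q t| * Real.exp (-(α * (A t - A x)))) (Ioi x) := by
    refine Integrable.mono' hq.abs.integrableOn ((hq.abs.aestronglyMeasurable.mul
      (Continuous.aestronglyMeasurable (by fun_prop))).restrict) ?_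
    refine (ae_restrict_iff' measurableSet_Ioi).2 (ae_of_all _ fun t ht => ?_)
    rw [Real.norm_of_nonneg (by positivity)]
    refine mul_le_of_le_one_right (abs_nonneg _) (Real.exp_le_one_iff.2 ?_)
    have := mul_nonneg hα.le (sub_nonneg.2 (hmono (le_of_lt ht)))
    linarith
  refine ⟨hi, le_of_tendsto (intervalIntegral_tendsto_integral_Ioi x hi tendsto_id)
    ((eventually_ge_atTop x).mono fun R hR => ?_)⟩
  have hE : LocallyAC fun t => -(1 / α) * Real.exp (-(α * (A t - A x))) :=
    (((hA.sub (LocallyAC.of_contDiff contDiff_const)).const_mul α).neg.exp).const_mul _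
  have hEd : ∀ᵐ t, HasDerivAt (fun t => -(1 / α) * Real.exp (-(α * (A t - A x))))
      (|q t| * Real.exp (-(α * (A t - A x)))) t := by
    filter_upwards [hAd] with t ht
    refine ((((ht.sub_const (A x)).const_mul α).neg.exp).const_mul _).congr_deriv ?_
    simp only [Pi.neg_apply]
    field_simp
  rw [id, hE.integral_eq hEd]
  simp only [sub_self, mul_zero, neg_zero, Real.exp_zero, mul_one]
  have : 0 < 1 / α * Real.exp (-(α * (A R - A x))) := by positivity
  linarith

/-- The integral equation of the Jost solutions, solved simultaneously, and continuously in `k`, for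
all `k ≥ ε`. -/
theorem exists_jost_integral_equation {q : ℝ → ℝ} (hq : Integrable q) {ε : ℝ} (hε : 0 < ε) :
    ∃ (h : ℝ × ℝ → ℝ) (C : ℝ), Continuous h ∧ (∀ p, |h p| ≤ C) ∧
      ∀ x k, h (x, k) = 1 + ∫ t, jostKernel (max ε k) (t - x) * (q t * h (t, k)) := by
  have hi : ∀ a b : ℝ, IntervalIntegrable (fun x => |q x|) volume a b := fun a b =>
    hq.abs.intervalIntegrable
  set A : ℝ → ℝ := fun x => ∫ t in (0 : ℝ)..x, |q t| with hAdef
  have hA : LocallyAC A := LocallyAC.of_integral hi 0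
  have hAd : ∀ᵐ x, HasDerivAt A (|q x|) x := LocallyAC.ae_hasDerivAt_integral hi 0
  have hAc := hA.continuous
  have hmono : Monotone A := fun a b hab =>
    hA.le_of_deriv_nonneg hab (hAd.mono fun x hx _ => ⟨_, abs_nonneg _, hx⟩)
  have hAb : ∀ x, |A x| ≤ ∫ t, |q t| := fun x => by
    have := (norm_integral_le_integral_norm_uIoc (f := fun t => |q t|) (a := 0) (b := x)
      (μ := volume))
    simp only [Real.norm_eq_abs, abs_abs] at this
    exact this.trans (setIntegral_le_integral hq.abs (ae_of_all _ fun t => abs_nonneg _))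
  -- The substitution `y = e^{αA} h` turns the integral equation into a contraction: the kernel is
  -- at most `1 / (2ε)` and the weight integral at most `1 / α = ε`, so the constant is `1/2`.
  set α : ℝ := 1 / ε with hαdef
  have hα : 0 < α := by positivity
  -- Truncating `k` at `ε` makes the equation meaningful on all of `ℝ × ℝ`. One fixed point among
  -- bounded continuous functions of `(x, k)` then gives joint continuity and a bound uniform in
  -- `k`.
  set κ : ℝ → ℝ := fun k => max ε k with hκdef
  have hκ : ∀ k, ε ≤ κ k := fun k => le_max_left _ _
  have hκ0 : ∀ k, 0 < κ k := fun k => hε.trans_le (hκ k)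
  have hκc : Continuous κ := continuous_const.max continuous_id
  set L : ℝ × ℝ → ℝ → ℝ := fun p t =>
    jostKernel (κ p.2) (t - p.1) * (q t * Real.exp (-(α * (A t - A p.1)))) with hL
  have hLle : ∀ p t, |L p t| ≤ (Ioi p.1).indicator
      (fun t => 1 / (2 * ε) * (|q t| * Real.exp (-(α * (A t - A p.1))))) t := fun p t => by
    by_cases ht : t ∈ Ioi p.1
    · rw [indicator_of_mem ht, abs_mul, abs_mul, Real.abs_exp,
        abs_of_nonneg (jostKernel_nonneg (hκ0 _) _)]
      refine mul_le_mul_of_nonneg_right ((jostKernel_le (hκ0 _) _).trans ?_) (by positivity)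
      exact one_div_le_one_div_of_le (by linarith) (by linarith [hκ p.2])
    · rw [indicator_of_notMem ht]
      simp only [hL]
      rw [jostKernel_of_nonpos _ (by simpa using ht), zero_mul, abs_zero]
  have hLle' : ∀ p t, |L p t| ≤ 1 / (2 * ε) * |q t| := fun p t => by
    refine (hLle p t).trans (indicator_le_indicator' (s := Ioi p.1) (g := fun t => 1 / (2 * ε) * |q t|)
      (fun ht => ?_) |>.trans (indicator_le_self' (fun _ _ => by positivity) t))
    refine mul_le_mul_of_nonneg_left (mul_le_of_le_one_right (abs_nonneg _)
      (Real.exp_le_one_iff.2 ?_)) (by positivity)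
    have := mul_nonneg hα.le (sub_nonneg.2 (hmono (le_of_lt ht)))
    linarith
  have hLm : ∀ p, AEStronglyMeasurable (L p) volume := fun p => by
    refine AEStronglyMeasurable.mul (Continuous.aestronglyMeasurable ?_)
      (hq.aestronglyMeasurable.mul (Continuous.aestronglyMeasurable (by fun_prop)))
    unfold jostKernel
    have := hκ0 p.2
    fun_prop (disch := positivity)
  have hLc : ∀ t, Continuous fun p => L p t := fun t => by
    simp only [hL]
    unfold jostKernel
    refine Continuous.mul (Continuous.div ?_ ?_ fun p => ?_) ?_
    · fun_prop
    · fun_prop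
    · have := hκ0 p.2
      positivity
    · fun_prop
  have hLi : ∀ p, ∫ t, |L p t| ≤ 1 / 2 := fun p => by
    obtain ⟨hint, hle⟩ := integral_abs_mul_exp_le hq hA hAd hmono hα p.1
    calc ∫ t, |L p t| ≤ ∫ t, (Ioi p.1).indicator
          (fun t => 1 / (2 * ε) * (|q t| * Real.exp (-(α * (A t - A p.1))))) t := by
          refine integral_mono_of_nonneg (ae_of_all _ fun t => abs_nonneg _) ?_
            (ae_of_all _ (hLle p))
          exact (integrable_indicator_iff measurableSet_Ioi).2 (hint.const_mul _)
      _ = 1 / (2 * ε) * ∫ t in Ioi p.1, |q t| * Real.exp (-(α * (A t - A p.1))) := by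
          rw [MeasureTheory.integral_indicator measurableSet_Ioi, MeasureTheory.integral_const_mul]
      _ ≤ 1 / (2 * ε) * (1 / α) := mul_le_mul_of_nonneg_left hle (by positivity)
      _ = 1 / 2 := by rw [hαdef]; field_simp
  have hLyb : ∀ (y : BoundedContinuousFunction (ℝ × ℝ) ℝ) p t,
      |L p t * y (t, p.2)| ≤ |L p t| * ‖y‖ := fun y p t => by
    rw [abs_mul]
    exact mul_le_mul_of_nonneg_left (y.norm_coe_le_norm _) (abs_nonneg _)
  have hLint : ∀ p, Integrable (L p) := fun p =>
    (hq.abs.const_mul (1 / (2 * ε))).mono' (hLm p) (ae_of_all _ (hLle' p))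
  have hLym : ∀ (y : BoundedContinuousFunction (ℝ × ℝ) ℝ) p,
      AEStronglyMeasurable (fun t => L p t * y (t, p.2)) volume := fun y p =>
    (hLm p).mul (y.continuous.comp (by fun_prop : Continuous fun t : ℝ =>
      (t, p.2))).aestronglyMeasurable
  have hLyi : ∀ (y : BoundedContinuousFunction (ℝ × ℝ) ℝ) p,
      Integrable (fun t => L p t * y (t, p.2)) := fun y p =>
    ((hLint p).abs.mul_const ‖y‖).mono' (hLym y p) (ae_of_all _ (hLyb y p))
  have hLyn : ∀ (y : BoundedContinuousFunction (ℝ × ℝ) ℝ) p,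
      |∫ t, L p t * y (t, p.2)| ≤ 1 / 2 * ‖y‖ := fun y p => by
    have hb : ∀ t, ‖L p t * y (t, p.2)‖ ≤ |L p t| * ‖y‖ := hLyb y p
    refine (MeasureTheory.norm_integral_le_of_norm_le ((hLint p).abs.mul_const ‖y‖)
      (ae_of_all _ hb)).trans ?_
    rw [MeasureTheory.integral_mul_const]
    exact mul_le_mul_of_nonneg_right (hLi p) (norm_nonneg _)
  have hLyc : ∀ y : BoundedContinuousFunction (ℝ × ℝ) ℝ,
      Continuous fun p : ℝ × ℝ => ∫ t, L p t * y (t, p.2) := fun y => by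
    refine continuous_of_dominated (bound := fun t => 1 / (2 * ε) * |q t| * ‖y‖) (hLym y)
      (fun p => ae_of_all _ fun t => (hLyb y p t).trans
        (mul_le_mul_of_nonneg_right (hLle' p t) (norm_nonneg _)))
      ((hq.abs.const_mul _).mul_const _) (ae_of_all _ fun t => (hLc t).mul ?_)
    exact y.continuous.comp (by fun_prop)
  let T : BoundedContinuousFunction (ℝ × ℝ) ℝ → BoundedContinuousFunction (ℝ × ℝ) ℝ := fun y =>
    BoundedContinuousFunction.ofNormedAddCommGroup
      (fun p => Real.exp (α * A p.1) + ∫ t, L p t * y (t, p.2))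
      (Continuous.add (by fun_prop) (hLyc y)) (Real.exp (α * ∫ t, |q t|) + 1 / 2 * ‖y‖) fun p => by
        refine (norm_add_le _ _).trans (add_le_add ?_ (hLyn y p))
        rw [Real.norm_of_nonneg (Real.exp_pos _).le]
        exact Real.exp_le_exp.2 (mul_le_mul_of_nonneg_left ((le_abs_self _).trans (hAb _)) hα.le)
  have hT : ContractingWith (1 / 2) T := by
    refine ⟨by rw [← NNReal.coe_lt_coe]; norm_num, LipschitzWith.of_dist_le_mul fun y z => ?_⟩
    rw [dist_eq_norm, dist_eq_norm]
    refine (BoundedContinuousFunction.norm_le (by positivity)).2 fun p => ?_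
    have : (T y - T z) p = ∫ t, L p t * (y - z) (t, p.2) := by
      simp only [T, BoundedContinuousFunction.coe_sub, Pi.sub_apply,
        BoundedContinuousFunction.coe_ofNormedAddCommGroup, mul_sub]
      rw [MeasureTheory.integral_sub (hLyi y p) (hLyi z p)]
      ring
    rw [this]
    simpa using hLyn (y - z) p
  obtain ⟨y, hy⟩ : ∃ y, T y = y := ⟨_, hT.fixedPoint_isFixedPt⟩
  have hyp : ∀ p, y p = Real.exp (α * A p.1) + ∫ t, L p t * y (t, p.2) := fun p => by
    conv_lhs => rw [← hy]
    rfl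
  refine ⟨fun p => Real.exp (-(α * A p.1)) * y p, Real.exp (α * ∫ t, |q t|) * ‖y‖,
    Continuous.mul (by fun_prop) y.continuous, fun p => ?_, fun x k => ?_⟩
  · rw [abs_mul, Real.abs_exp]
    refine mul_le_mul (Real.exp_le_exp.2 ?_) (y.norm_coe_le_norm _) (abs_nonneg _)
      (Real.exp_pos _).le
    rw [← mul_neg]
    exact mul_le_mul_of_nonneg_left ((neg_le_abs _).trans (hAb _)) hα.le
  · simp only
    rw [hyp, mul_add, ← Real.exp_add, neg_add_cancel, Real.exp_zero,
      ← MeasureTheory.integral_const_mul]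
    congr 2
    ext t
    simp only [hL]
    rw [show -(α * (A t - A x)) = α * A x + -(α * A t) by ring, Real.exp_add,
      show Real.exp (-(α * A x)) = (Real.exp (α * A x))⁻¹ from Real.exp_neg _]
    have := Real.exp_pos (α * A x)
    field_simp
    ring

theorem integral_Ioi_eq_sub {p : ℝ → ℝ} (hp : ∀ a, IntegrableOn p (Ioi a)) (x : ℝ) :
    ∫ t in Ioi x, p t = (∫ t in Ioi 0, p t) - ∫ t in (0 : ℝ)..x, p t := by
  rw [← integral_Ioi_sub_Ioi' (hp 0) (hp x)]
  ring

theorem intervalIntegrable_of_integrableOn_Ioi {p : ℝ → ℝ} (hp : ∀ a, IntegrableOn p (Ioi a))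
    (a b : ℝ) : IntervalIntegrable p volume a b :=
  ⟨(hp a).mono_set Ioc_subset_Ioi_self, (hp b).mono_set Ioc_subset_Ioi_self⟩

theorem LocallyAC.integral_Ioi {p : ℝ → ℝ} (hp : ∀ a, IntegrableOn p (Ioi a)) :
    LocallyAC fun x => ∫ t in Ioi x, p t := by
  rw [show (fun x => ∫ t in Ioi x, p t) = _ from funext (integral_Ioi_eq_sub hp)]
  exact (LocallyAC.of_contDiff contDiff_const).sub
    (LocallyAC.of_integral (intervalIntegrable_of_integrableOn_Ioi hp) 0)

theorem ae_hasDerivAt_integral_Ioi {p : ℝ → ℝ} (hp : ∀ a, IntegrableOn p (Ioi a)) :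
    ∀ᵐ x, HasDerivAt (fun x => ∫ t in Ioi x, p t) (-p x) x := by
  rw [show (fun x => ∫ t in Ioi x, p t) = _ from funext (integral_Ioi_eq_sub hp)]
  filter_upwards [LocallyAC.ae_hasDerivAt_integral (intervalIntegrable_of_integrableOn_Ioi hp) 0]
    with x hx
  exact hx.const_sub _

theorem integrableOn_exp_mul {p : ℝ → ℝ} (hp : Integrable p) {κ : ℝ} (hκ : 0 ≤ κ) (x a : ℝ) :
    IntegrableOn (fun t => Real.exp (-(κ * (t - x))) * p t) (Ioi a) := by
  refine Integrable.bdd_mul hp.integrableOn (Continuous.aestronglyMeasurable (by fun_prop))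
    (c := Real.exp (-(κ * (a - x)))) ?_
  refine (ae_restrict_iff' measurableSet_Ioi).2 (ae_of_all _ fun t ht => ?_)
  rw [Real.norm_of_nonneg (Real.exp_pos _).le]
  refine Real.exp_le_exp.2 (neg_le_neg (mul_le_mul_of_nonneg_left ?_ hκ))
  have : a < t := ht
  linarith

/-- A solution `h` of the Jost integral equation solves `h'' = 2 κ h' + q h`. -/
theorem jost_hasDerivAt {p h : ℝ → ℝ} (hp : Integrable p) {κ : ℝ} (hκ : 0 < κ)
    (hh : ∀ x, h x = 1 + ∫ t, jostKernel κ (t - x) * p t) :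
    (∀ x, HasDerivAt h (-∫ t in Ioi x, Real.exp (-(2 * κ * (t - x))) * p t) x) ∧
      (LocallyAC fun x => -∫ t in Ioi x, Real.exp (-(2 * κ * (t - x))) * p t) ∧
      ∀ᵐ x, HasDerivAt (fun x => -∫ t in Ioi x, Real.exp (-(2 * κ * (t - x))) * p t)
        (2 * κ * (-∫ t in Ioi x, Real.exp (-(2 * κ * (t - x))) * p t) + p x) x := by
  have h2κ : 0 ≤ 2 * κ := by linarith
  set J : ℝ → ℝ := fun x => ∫ t in Ioi x, Real.exp (-(2 * κ * t)) * p t with hJdef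
  have hpJ : ∀ a, IntegrableOn (fun t => Real.exp (-(2 * κ * t)) * p t) (Ioi a) := fun a => by
    simpa using integrableOn_exp_mul hp h2κ 0 a
  have hJ : LocallyAC J := LocallyAC.integral_Ioi hpJ
  have hJd : ∀ᵐ x, HasDerivAt J (-(Real.exp (-(2 * κ * x)) * p x)) x :=
    ae_hasDerivAt_integral_Ioi hpJ
  have hpG : ∀ a, IntegrableOn p (Ioi a) := fun a => hp.integrableOn
  set G : ℝ → ℝ := fun x => ∫ t in Ioi x, p t with hGdef
  have hG : LocallyAC G := LocallyAC.integral_Ioi hpG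
  have hGd : ∀ᵐ x, HasDerivAt G (-p x) x := ae_hasDerivAt_integral_Ioi hpG
  -- Factoring out `e^{2κx}` leaves an integrand independent of `x`, so only the endpoint is
  -- differentiated.
  have hexp : ∀ x t, Real.exp (-(2 * κ * (t - x))) * p t
      = Real.exp (2 * κ * x) * (Real.exp (-(2 * κ * t)) * p t) := fun x t => by
    rw [← mul_assoc, ← Real.exp_add]
    ring_nf
  have hd : ∀ x, -∫ t in Ioi x, Real.exp (-(2 * κ * (t - x))) * p t
      = -(Real.exp (2 * κ * x) * J x) := fun x => by
    simp_rw [hexp, MeasureTheory.integral_const_mul]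
    rfl
  have hhJ : h = fun x => 1 + 1 / (2 * κ) * (G x - Real.exp (2 * κ * x) * J x) := by
    ext x
    rw [hh]
    congr 1
    have h1 : (fun t => jostKernel κ (t - x) * p t) = (Ioi x).indicator
        fun t => 1 / (2 * κ) * (p t - Real.exp (2 * κ * x) * (Real.exp (-(2 * κ * t)) * p t)) := by
      ext t
      by_cases ht : t ∈ Ioi x
      · rw [indicator_of_mem ht, ← hexp]
        have : x < t := ht
        rw [jostKernel, max_eq_left (by linarith)]
        ring
      · rw [indicator_of_notMem ht, jostKernel_of_nonpos _ (by simpa using ht), zero_mul]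
    rw [h1, MeasureTheory.integral_indicator measurableSet_Ioi, MeasureTheory.integral_const_mul,
      MeasureTheory.integral_sub (hpG x) ((hpJ x).const_mul _), MeasureTheory.integral_const_mul]
  have hE : ∀ x, HasDerivAt (fun x => Real.exp (2 * κ * x)) (2 * κ * Real.exp (2 * κ * x)) x :=
    fun x => (((hasDerivAt_id x).const_mul (2 * κ)).exp).congr_deriv (by simp; ring)
  have hEac : LocallyAC fun x => Real.exp (2 * κ * x) :=
    LocallyAC.of_hasDerivAt hE (by fun_prop)
  have hdac : LocallyAC fun x => -(Real.exp (2 * κ * x) * J x) := (hEac.mul hJ).neg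
  have hee : ∀ x, Real.exp (2 * κ * x) * Real.exp (-(2 * κ * x)) = 1 := fun x => by
    rw [← Real.exp_add, add_neg_cancel, Real.exp_zero]
  have hhac : LocallyAC h := by
    rw [hhJ]
    exact (LocallyAC.of_contDiff contDiff_const).add ((hG.sub (hEac.mul hJ)).const_mul _)
  simp_rw [hd]
  refine ⟨hhac.hasDerivAt_of_ae ?_ hdac.continuous, hdac, ?_⟩
  · filter_upwards [hGd, hJd] with x hGx hJx
    rw [hhJ]
    refine (((hGx.sub ((hE x).mul hJx)).const_mul _).const_add 1).congr_deriv ?_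
    have := hee x
    field_simp
    linear_combination p x * this
  · filter_upwards [hJd] with x hJx
    refine ((hE x).mul hJx).neg.congr_deriv ?_
    have := hee x
    linear_combination p x * this

/-! ### Properties of the Jost solutions -/

/-- `h k x = e^{kx} f`, where `f` is the Jost solution with energy `-k²` and `h' = d`. -/
structure JostFamily (q : ℝ → ℝ) (ε : ℝ) (h d : ℝ → ℝ → ℝ) : Prop where
  hasDerivAt : ∀ k ≥ ε, ∀ x, HasDerivAt (h k) (d k x) x
  absCont : ∀ k ≥ ε, LocallyAC (d k)
  equation : ∀ k ≥ ε, ∀ᵐ x, HasDerivAt (d k) (2 * k * d k x + q x * h k x) x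
  bounded : ∃ C, ∀ k ≥ ε, ∀ x, |h k x| ≤ C
  sub_one_le : ∀ k ≥ ε, ∀ x, |h k x - 1| ≤ 1 / (2 * k) * ∫ t in Ioi x, |q t * h k t|
  deriv_le : ∀ k ≥ ε, ∀ x, |d k x| ≤ ∫ t in Ioi x, |q t * h k t|
  continuousOn : ∀ x, ContinuousOn (fun k => h k x) (Ici ε)
  continuousOn_deriv : ∀ x, ContinuousOn (fun k => d k x) (Ici ε)

theorem exists_jostFamily {q : ℝ → ℝ} (hq : Integrable q) {ε : ℝ} (hε : 0 < ε) :
    ∃ h d, JostFamily q ε h d := by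
  obtain ⟨H, C, hHc, hHC, hH⟩ := exists_jost_integral_equation hq hε
  have hHt : ∀ k, Continuous fun t => H (t, k) := fun k => hHc.comp (by fun_prop)
  have hp : ∀ k, Integrable fun t => q t * H (t, k) := fun k =>
    hq.mul_bdd (hHt k).aestronglyMeasurable (ae_of_all _ fun t => hHC (t, k))
  have hk0 : ∀ k ≥ ε, 0 < k := fun k hk => hε.trans_le hk
  have key := fun k (hk : k ≥ ε) => jost_hasDerivAt (hp k) (hk0 k hk) (h := fun x => H (x, k))
    fun x => by rw [hH x k, max_eq_right hk]
  refine ⟨fun k x => H (x, k),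
    fun k x => -∫ t in Ioi x, Real.exp (-(2 * k * (t - x))) * (q t * H (t, k)),
    fun k hk => (key k hk).1, fun k hk => (key k hk).2.1, fun k hk => (key k hk).2.2,
    ⟨C, fun k _ x => hHC (x, k)⟩, fun k hk x => ?_, fun k hk x => ?_, fun x => ?_, fun x => ?_⟩
  · have hk' := hk0 k hk
    rw [hH x k, max_eq_right hk, add_sub_cancel_left, ← MeasureTheory.integral_const_mul,
      ← MeasureTheory.integral_indicator measurableSet_Ioi, ← Real.norm_eq_abs]
    refine MeasureTheory.norm_integral_le_of_norm_le ?_ (ae_of_all _ fun t => ?_)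
    · exact (integrable_indicator_iff measurableSet_Ioi).2 ((hp k).abs.const_mul _).integrableOn
    · by_cases ht : t ∈ Ioi x
      · rw [indicator_of_mem ht, norm_mul, Real.norm_of_nonneg (jostKernel_nonneg hk' _)]
        exact mul_le_mul_of_nonneg_right (jostKernel_le hk' _) (abs_nonneg _)
      · rw [indicator_of_notMem ht, jostKernel_of_nonpos _ (by simpa using ht), zero_mul, norm_zero]
  · have hk' := hk0 k hk
    rw [abs_neg, ← Real.norm_eq_abs]
    refine MeasureTheory.norm_integral_le_of_norm_le (hp k).abs.integrableOn
      ((ae_restrict_iff' measurableSet_Ioi).2 (ae_of_all _ fun t ht => ?_))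
    rw [norm_mul, Real.norm_of_nonneg (Real.exp_pos _).le]
    refine mul_le_of_le_one_left (abs_nonneg _) (Real.exp_le_one_iff.2 ?_)
    have : 0 ≤ k * (t - x) := mul_nonneg hk'.le (sub_nonneg.2 (le_of_lt ht))
    linarith
  · exact (hHc.comp (by fun_prop)).continuousOn
  · refine ContinuousOn.neg (continuousOn_of_dominated (bound := fun t => |q t| * C)
      (fun k hk => ?_) (fun k hk => ?_) (hq.abs.mul_const C).integrableOn
      (ae_of_all _ fun t => Continuous.continuousOn ?_))
    · exact ((Continuous.aestronglyMeasurable (by fun_prop)).mul (hp k).aestronglyMeasurable).restrict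
    · refine (ae_restrict_iff' measurableSet_Ioi).2 (ae_of_all _ fun t ht => ?_)
      rw [norm_mul, norm_mul, Real.norm_of_nonneg (Real.exp_pos _).le]
      have h1 : 0 ≤ k * (t - x) := mul_nonneg (hk0 k hk).le (sub_nonneg.2 (le_of_lt ht))
      refine (mul_le_of_le_one_left (by positivity) (Real.exp_le_one_iff.2 (by linarith))).trans ?_
      exact mul_le_mul_of_nonneg_left (hHC (t, k)) (norm_nonneg _)
    · exact Continuous.mul (by fun_prop) (continuous_const.mul (hHc.comp (by fun_prop)))

theorem tendsto_integral_Ioi_zero {p : ℝ → ℝ} (hp : Integrable p) :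
    Tendsto (fun x => ∫ t in Ioi x, p t) atTop (𝓝 0) := by
  rw [show (fun x => ∫ t in Ioi x, p t) = _ from
    funext (integral_Ioi_eq_sub fun a => hp.integrableOn)]
  simpa using (intervalIntegral_tendsto_integral_Ioi 0 hp.integrableOn tendsto_id).const_sub
    (∫ t in Ioi 0, p t)

namespace JostFamily

variable {q : ℝ → ℝ} {ε : ℝ} {h d : ℝ → ℝ → ℝ}

theorem hasDerivAt_solution (H : JostFamily q ε h d) {k : ℝ} (hk : ε ≤ k) (x : ℝ) :
    HasDerivAt (fun x => Real.exp (-(k * x)) * h k x)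
      (Real.exp (-(k * x)) * (d k x - k * h k x)) x := by
  have hE : HasDerivAt (fun x => Real.exp (-(k * x))) (-k * Real.exp (-(k * x))) x :=
    (((hasDerivAt_id x).const_mul k).neg.exp).congr_deriv (by simp; ring)
  exact (hE.mul (H.hasDerivAt k hk x)).congr_deriv (by ring)

theorem isSolution (H : JostFamily q ε h d) {k : ℝ} (hk : ε ≤ k) :
    IsSolution q (-k ^ 2) fun x => Real.exp (-(k * x)) * h k x := by
  have hE : ∀ x, HasDerivAt (fun x => Real.exp (-(k * x))) (-k * Real.exp (-(k * x))) x := fun x =>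
    (((hasDerivAt_id x).const_mul k).neg.exp).congr_deriv (by simp; ring)
  refine IsSolution.of_hasDerivAt (H.hasDerivAt_solution hk) ?_ ?_
  · exact (LocallyAC.of_hasDerivAt hE (by fun_prop)).mul ((H.absCont k hk).sub
      ((LocallyAC.of_hasDerivAt (H.hasDerivAt k hk) (H.absCont k hk).continuous).const_mul k))
  · filter_upwards [H.equation k hk] with x hx
    exact ((hE x).mul (hx.sub ((H.hasDerivAt k hk x).const_mul k))).congr_deriv (by
      simp only [Pi.sub_apply]; ring)

theorem continuous (H : JostFamily q ε h d) {k : ℝ} (hk : ε ≤ k) : Continuous (h k) :=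
  continuous_iff_continuousAt.2 fun x => (H.hasDerivAt k hk x).continuousAt

theorem integrableOn_sq (H : JostFamily q ε h d) {k : ℝ} (hk : ε ≤ k) (hk0 : 0 < k) (a : ℝ) :
    IntegrableOn (fun x => (Real.exp (-(k * x)) * h k x) ^ 2) (Ici a) := by
  obtain ⟨C, hC⟩ := H.bounded
  have hc := H.continuous hk
  have h1 : IntegrableOn (fun x => Real.exp (-(2 * k) * x)) (Ici a) :=
    by
      rw [integrableOn_Ici_iff_integrableOn_Ioi]
      exact integrableOn_exp_mul_Ioi (by linarith) a
  refine Integrable.mono' (h1.mul_const (C ^ 2)) (Continuous.aestronglyMeasurable (by fun_prop))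
    (ae_of_all _ fun x => ?_)
  rw [Real.norm_of_nonneg (sq_nonneg _), mul_pow, ← Real.exp_nat_mul]
  refine mul_le_mul (Real.exp_le_exp.2 (by push_cast; linarith)) ?_ (sq_nonneg _)
    (Real.exp_pos _).le
  exact sq_le_sq' (abs_le.1 (hC k hk x)).1 (abs_le.1 (hC k hk x)).2

theorem integrable_mul (H : JostFamily q ε h d) (hq : Integrable q) {k : ℝ} (hk : ε ≤ k) :
    Integrable fun t => |q t * h k t| := by
  obtain ⟨C, hC⟩ := H.bounded
  exact (hq.mul_bdd (H.continuous hk).aestronglyMeasurable (ae_of_all _ fun t => hC k hk t)).abs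

theorem tendsto_one (H : JostFamily q ε h d) (hq : Integrable q) {k : ℝ} (hk : ε ≤ k) :
    Tendsto (h k) atTop (𝓝 1) := by
  refine tendsto_iff_norm_sub_tendsto_zero.2 ?_
  refine squeeze_zero (fun x => norm_nonneg _) (H.sub_one_le k hk) ?_
  simpa using (tendsto_integral_Ioi_zero (H.integrable_mul hq hk)).const_mul (1 / (2 * k))

theorem tendsto_zero (H : JostFamily q ε h d) (hq : Integrable q) {k : ℝ} (hk : ε ≤ k) :
    Tendsto (d k) atTop (𝓝 0) :=
  squeeze_zero_norm (H.deriv_le k hk) (tendsto_integral_Ioi_zero (H.integrable_mul hq hk))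

/-- The half-line integral decreases as its base point moves right, so Bargmann's inequality
excludes any zero in `[a, ∞)`; the limit `1` at infinity fixes the sign. -/
theorem pos_of_bargmann (H : JostFamily q ε h d) (hq : Integrable q) {k : ℝ} (hk : ε ≤ k)
    (hk0 : 0 < k) {a : ℝ}
    (hm : ∫⁻ x in Ici a, ENNReal.ofReal ((x - a) * max (-q x) 0) < 1) {x : ℝ} (hx : a ≤ x) :
    0 < h k x := by
  have hne : ∀ y ≥ a, h k y ≠ 0 := fun y hy h0 => by
    have hm' : ∫⁻ x in Ici y, ENNReal.ofReal ((x - y) * max (-q x) 0) < 1 := by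
      refine lt_of_le_of_lt ?_ hm
      refine (lintegral_mono fun t => ENNReal.ofReal_le_ofReal ?_).trans
        (lintegral_mono_set (Ici_subset_Ici.2 hy))
      exact mul_le_mul_of_nonneg_right (by linarith) (le_max_right _ _)
    have hz := (H.isSolution hk).eq_zero_of_bargmann hq (neg_nonpos.2 (sq_nonneg k)) (a := y)
      (by simp [h0]) (H.integrableOn_sq hk hk0 y) hm'
    have hz' : h k = fun _ => 0 := funext fun t => by
      simpa [(Real.exp_pos _).ne'] using hz t
    have := H.tendsto_one hq hk
    rw [hz'] at this
    exact zero_ne_one (tendsto_nhds_unique tendsto_const_nhds this)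
  by_contra! hneg
  obtain ⟨R, hR1, hR2⟩ := (((H.tendsto_one hq hk).eventually (lt_mem_nhds one_pos)).and
    (eventually_ge_atTop x)).exists
  obtain ⟨y, hy, hy0⟩ := intermediate_value_Icc hR2 (H.continuous hk).continuousOn
    ⟨hneg, hR1.le⟩
  exact hne y (hx.trans hy.1) hy0

/-- Riccati comparison for `h' / h`. -/
theorem neg_div_le_integral (H : JostFamily q ε h d) (hq : Integrable q) {k : ℝ} (hk : ε ≤ k)
    (hk0 : 0 < k) {a : ℝ} (hpos : ∀ x ≥ a, 0 < h k x) :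
    -(d k a / h k a) ≤ ∫ x in Ioi a, Real.exp (-(2 * k * (x - a))) * q x := by
  have hE : ∀ x, HasDerivAt (fun x => Real.exp (-(2 * k * (x - a))))
      (-(2 * k) * Real.exp (-(2 * k * (x - a)))) x := fun x =>
    ((((hasDerivAt_id x).sub_const a).const_mul (2 * k)).neg.exp).congr_deriv (by simp; ring)
  have hi := integrableOn_exp_mul hq (by linarith : 0 ≤ 2 * k) a a
  have hlim : Tendsto (fun x => d k x * (h k x)⁻¹ * Real.exp (-(2 * k * (x - a)))) atTop (𝓝 0) := by
    have h1 : Tendsto (fun x => Real.exp (-(2 * k * (x - a)))) atTop (𝓝 0) :=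
      Real.tendsto_exp_neg_atTop_nhds_zero.comp
        ((tendsto_atTop_add_const_right _ (-a) tendsto_id).const_mul_atTop
          (by linarith : 0 < 2 * k))
    simpa using ((H.tendsto_zero hq hk).mul ((H.tendsto_one hq hk).inv₀ one_ne_zero)).mul h1
  -- With `r = d / h`, the equation gives `r' = 2 k r + q - r²`, so `(r e^{-2k(x-a)})' = (q - r²)
  -- e^{-2k(x-a)} ≤ q e^{-2k(x-a)}`.
  have hle : ∀ R ≥ a, d k R * (h k R)⁻¹ * Real.exp (-(2 * k * (R - a))) - d k a / h k a ≤
      ∫ x in a..R, Real.exp (-(2 * k * (x - a))) * q x := fun R hR => by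
    have hinv : AbsolutelyContinuousOnInterval (fun x => (h k x)⁻¹) a R := by
      refine ContDiffOn.absolutelyContinuousOnInterval (ContDiffOn.inv ?_ fun x hx => ?_)
      · refine (contDiff_one_iff_deriv.2
          ⟨fun x => (H.hasDerivAt k hk x).differentiableAt, ?_⟩).contDiffOn
        rw [show deriv (h k) = d k from funext fun x => (H.hasDerivAt k hk x).deriv]
        exact (H.absCont k hk).continuous
      · rw [uIcc_of_le hR] at hx
        exact (hpos x hx.1).ne'
    have hF := ((H.absCont k hk a R).fun_mul hinv).fun_mul
      (LocallyAC.of_hasDerivAt hE (by fun_prop) a R)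
    have h1 := hF.sub_le_integral hR ((intervalIntegrable_iff_integrableOn_Ioc_of_le hR).2
      (hi.mono_set Ioc_subset_Ioi_self)) ?_
    · simpa [div_eq_mul_inv] using h1
    · filter_upwards [H.equation k hk] with x hx hxI
      have hp := hpos x hxI.1
      refine ⟨_, ?_, (hx.mul ((H.hasDerivAt k hk x).inv hp.ne')).mul (hE x)⟩
      have h3 : 0 ≤ d k x ^ 2 / h k x ^ 2 * Real.exp (-(2 * k * (x - a))) := by positivity
      have h4 : h k x * (h k x)⁻¹ = 1 := mul_inv_cancel₀ hp.ne'
      simp only [Pi.mul_apply, Pi.inv_apply]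
      linear_combination h3 + q x * Real.exp (-(2 * k * (x - a))) * h4
  have := le_of_tendsto_of_tendsto (hlim.sub_const (d k a / h k a))
    (intervalIntegral_tendsto_integral_Ioi a hi tendsto_id)
    ((eventually_ge_atTop a).mono fun R hR => hle R hR)
  simpa using this

/-- As `h` is bounded uniformly in `k`, `|d| ≤ |I|` and `|h - 1| ≤ |I| / (2k) ≤ 1/2`; hence `d - k h
≤ |I| - k/2 < 0` once `k ≥ 2|I| + 1`. -/
theorem exists_forall_large (H : JostFamily q ε h d) (hq : Integrable q) :
    ∃ K, ∀ k ≥ K, ε ≤ k → ∀ x, 0 < h k x ∧ d k x - k * h k x < 0 := by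
  obtain ⟨C, hC⟩ := H.bounded
  set I := ∫ t, |q t| * C with hI
  refine ⟨2 * |I| + 1, fun k hkK hk x => ?_⟩
  have hk0 : 0 < k := by linarith [abs_nonneg I]
  have h1 : ∫ t in Ioi x, |q t * h k t| ≤ |I| := by
    refine ((setIntegral_le_integral (H.integrable_mul hq hk)
      (ae_of_all _ fun t => abs_nonneg _)).trans ?_).trans (le_abs_self I)
    refine integral_mono (H.integrable_mul hq hk) (hq.abs.mul_const C) fun t => ?_
    rw [abs_mul]
    exact mul_le_mul_of_nonneg_left (hC k hk t) (abs_nonneg _)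
  have h2 := (abs_le.1 ((H.deriv_le k hk x).trans h1)).2
  have h3 : |h k x - 1| ≤ 1 / 2 := by
    refine (H.sub_one_le k hk x).trans ?_
    rw [one_div_mul_eq_div, div_le_iff₀ (by linarith)]
    linarith
  have h4 := (abs_le.1 h3).1
  refine ⟨by linarith, ?_⟩
  nlinarith

end JostFamily

/-! ### The half-line Bargmann integral as a function of its base point -/

/-- The half-line Bargmann integral. -/
noncomputable def halfBargmann (q : ℝ → ℝ) (x : ℝ) : ℝ := ∫ t, max (t - x) 0 * max (-q t) 0

section HalfBargmann

variable {q : ℝ → ℝ}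

theorem integrable_of_weighted (hq : Integrable fun x : ℝ => (1 + |x|) * q x) : Integrable q := by
  have hpos : ∀ x : ℝ, 0 < 1 + |x| := fun x => by positivity
  have hc : Continuous fun x : ℝ => (1 + |x|)⁻¹ :=
    Continuous.inv₀ (by fun_prop) fun x => (hpos x).ne'
  have := hq.bdd_mul hc.aestronglyMeasurable (c := 1) (ae_of_all _ fun x => by
    rw [Real.norm_of_nonneg (inv_nonneg.2 (hpos x).le)]
    exact inv_le_one_of_one_le₀ (by linarith [abs_nonneg x]))
  refine this.congr (ae_of_all _ fun x => ?_)
  exact inv_mul_cancel_left₀ (hpos x).ne' _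

theorem halfBargmann_integrand_le {q : ℝ → ℝ} {x t B : ℝ} (hB : 1 ≤ B) (hx : -x ≤ B) :
    ‖max (t - x) 0 * max (-q t) 0‖ ≤ B * |(1 + |t|) * q t| := by
  rw [Real.norm_of_nonneg (mul_nonneg (le_max_right _ _) (le_max_right _ _)), abs_mul,
    abs_of_nonneg (by positivity : 0 ≤ 1 + |t|), ← mul_assoc]
  refine mul_le_mul (max_le ?_ (by positivity)) (max_le (neg_le_abs _) (abs_nonneg _))
    (le_max_right _ _) (by positivity)
  nlinarith [le_abs_self t, abs_nonneg t]

theorem aestronglyMeasurable_halfBargmann_integrand (hq : Integrable q) (x : ℝ) :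
    AEStronglyMeasurable (fun t => max (t - x) 0 * max (-q t) 0) volume :=
  (Continuous.aestronglyMeasurable (by fun_prop)).mul hq.neg.pos_part.aestronglyMeasurable

theorem continuous_halfBargmann (hq : Integrable fun x : ℝ => (1 + |x|) * q x) :
    Continuous (halfBargmann q) := by
  refine continuous_iff_continuousAt.2 fun x => ?_
  refine continuousAt_of_dominated (bound := fun t => (|x| + 1) * |(1 + |t|) * q t|)
    (Eventually.of_forall fun y =>
      aestronglyMeasurable_halfBargmann_integrand (integrable_of_weighted hq) y)
    ?_ (hq.abs.const_mul _) (ae_of_all _ fun t => ?_)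
  · filter_upwards [lt_mem_nhds (show x - 1 < x by linarith)] with y hy
    exact ae_of_all _ fun t => halfBargmann_integrand_le (by linarith [abs_nonneg x])
      (by linarith [neg_le_abs x])
  · exact Continuous.continuousAt (by fun_prop)

theorem tendsto_halfBargmann (hq : Integrable fun x : ℝ => (1 + |x|) * q x) :
    Tendsto (halfBargmann q) atTop (𝓝 0) := by
  have := tendsto_integral_filter_of_dominated_convergence (l := atTop) (μ := volume)
    (F := fun x t => max (t - x) 0 * max (-q t) 0) (f := fun _ => 0)
    (fun t => 1 * |(1 + |t|) * q t|)
    (Eventually.of_forall fun y =>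
      aestronglyMeasurable_halfBargmann_integrand (integrable_of_weighted hq) y)
    ((eventually_ge_atTop 0).mono fun y hy => ae_of_all _ fun t =>
      halfBargmann_integrand_le le_rfl (by linarith))
    (hq.abs.const_mul _) (ae_of_all _ fun t => tendsto_const_nhds.congr' ?_)
  · simpa [halfBargmann] using! this
  · filter_upwards [eventually_ge_atTop t] with x hx
    rw [max_eq_right (by linarith), zero_mul]

theorem lintegral_eq_halfBargmann (hq : Integrable fun x : ℝ => (1 + |x|) * q x) (a : ℝ) :
    ∫⁻ x in Ici a, ENNReal.ofReal ((x - a) * max (-q x) 0) = ENNReal.ofReal (halfBargmann q a) := by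
  have hi : Integrable fun t => max (t - a) 0 * max (-q t) 0 :=
    (hq.abs.const_mul (|a| + 1)).mono'
      (aestronglyMeasurable_halfBargmann_integrand (integrable_of_weighted hq) a)
      (ae_of_all _ fun t => halfBargmann_integrand_le (by linarith [abs_nonneg a])
        (by linarith [neg_le_abs a]))
  rw [halfBargmann, ofReal_integral_eq_lintegral_ofReal hi
    (ae_of_all _ fun t => mul_nonneg (le_max_right _ _) (le_max_right _ _)),
    ← lintegral_indicator measurableSet_Ici]
  congr 1
  ext t
  by_cases ht : t ∈ Ici a
  · have : a ≤ t := ht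
    rw [indicator_of_mem ht, max_eq_left (sub_nonneg.2 this)]
  · have : t < a := not_le.1 ht
    rw [indicator_of_notMem ht, max_eq_right (by linarith), zero_mul, ENNReal.ofReal_zero]

theorem lintegral_eq_halfBargmann_left (hq : Integrable fun x : ℝ => (1 + |x|) * q x) (a : ℝ) :
    ∫⁻ x in Iic a, ENNReal.ofReal ((a - x) * max (-q x) 0)
      = ENNReal.ofReal (halfBargmann (fun x => q (-x)) (-a)) := by
  rw [← lintegral_eq_halfBargmann (by simpa using hq.comp_neg), ← setLIntegral_Iic_comp_neg]
  congr 1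
  ext t
  congr 2
  ring

/-- If `τ(q) < 1` there is a point on both sides of which the Bargmann integral is less than `1`. -/
theorem exists_halfBargmann_lt_one (hq : Integrable fun x : ℝ => (1 + |x|) * q x)
    (hτ : bargmannTau q < 1) :
    ∃ x, halfBargmann q x < 1 ∧ halfBargmann (fun x => q (-x)) (-x) < 1 := by
  have hq' : Integrable fun x : ℝ => (1 + |x|) * q (-x) := by simpa using hq.comp_neg
  have hc' : Continuous fun x => halfBargmann (fun x => q (-x)) (-x) :=
    (continuous_halfBargmann hq').comp continuous_neg
  -- `τ(q) < 1` says that these two open sets cover the line. Each is nonempty, by the decay of the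
  -- half-line integrals at `+∞` and `-∞`, so by connectedness they meet.
  have hcov : (univ : Set ℝ) ⊆
      {x | halfBargmann q x < 1} ∪ {x | halfBargmann (fun x => q (-x)) (-x) < 1} := fun x _ => by
    have hmin := (le_iSup (fun x₀ : ℝ =>
      min (∫⁻ x in Iic x₀, ENNReal.ofReal ((x₀ - x) * max (-q x) 0))
        (∫⁻ x in Ici x₀, ENNReal.ofReal ((x - x₀) * max (-q x) 0))) x).trans_lt hτ
    rw [lintegral_eq_halfBargmann hq, lintegral_eq_halfBargmann_left hq, min_lt_iff,
      ENNReal.ofReal_lt_one, ENNReal.ofReal_lt_one] at hmin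
    exact hmin.symm
  obtain ⟨a, ha⟩ := ((tendsto_halfBargmann hq).eventually (gt_mem_nhds one_pos)).exists
  obtain ⟨b, hb⟩ := ((tendsto_halfBargmann hq').eventually (gt_mem_nhds one_pos)).exists
  obtain ⟨x, -, hx⟩ := isPreconnected_univ _ _ (isOpen_lt (continuous_halfBargmann hq) continuous_const)
    (isOpen_lt hc' continuous_const) hcov ⟨a, mem_univ _, ha⟩
    ⟨-b, mem_univ _, by simpa using hb⟩
  exact ⟨x, hx⟩

end HalfBargmann

/-! ### Existence of a bound state -/

theorem tendsto_integral_exp_abs_mul {q : ℝ → ℝ} (hq : Integrable q) (a : ℝ) :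
    Tendsto (fun k => 2 * k + ∫ x, Real.exp (-(2 * k * |x - a|)) * q x) (𝓝[>] 0)
      (𝓝 (∫ x, q x)) := by
  have h1 : Tendsto (fun k : ℝ => 2 * k) (𝓝[>] 0) (𝓝 0) := by
    have : Continuous fun k : ℝ => 2 * k := by fun_prop
    simpa using (this.tendsto 0).mono_left nhdsWithin_le_nhds
  have h2 : Tendsto (fun k => ∫ x, Real.exp (-(2 * k * |x - a|)) * q x) (𝓝[>] 0)
      (𝓝 (∫ x, q x)) := by
    refine tendsto_integral_filter_of_dominated_convergence (fun x => |q x|)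
      (Eventually.of_forall fun k =>
        (Continuous.aestronglyMeasurable (by fun_prop)).mul hq.aestronglyMeasurable)
      ?_ hq.abs (ae_of_all _ fun x => ?_)
    · filter_upwards [self_mem_nhdsWithin] with k hk
      refine ae_of_all _ fun x => ?_
      rw [norm_mul, Real.norm_of_nonneg (Real.exp_pos _).le]
      refine mul_le_of_le_one_left (abs_nonneg _) (Real.exp_le_one_iff.2 ?_)
      have : 0 ≤ k * |x - a| := mul_nonneg (le_of_lt hk) (abs_nonneg _)
      linarith
    · have : Continuous fun k : ℝ => Real.exp (-(2 * k * |x - a|)) * q x := by fun_prop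
      simpa using (this.tendsto 0).mono_left nhdsWithin_le_nhds
  simpa using h1.add h2

theorem integrable_exp_abs_mul {q : ℝ → ℝ} (hq : Integrable q) {k : ℝ} (hk : 0 < k) (a : ℝ) :
    Integrable fun x => Real.exp (-(2 * k * |x - a|)) * q x := by
  refine hq.bdd_mul (Continuous.aestronglyMeasurable (by fun_prop)) (c := 1)
    (ae_of_all _ fun x => ?_)
  rw [Real.norm_of_nonneg (Real.exp_pos _).le]
  exact Real.exp_le_one_iff.2 (by have := abs_nonneg (x - a); nlinarith)

/-- The left side is the sum of the Riccati bounds for the two Jost solutions at `a`, the left one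
being seen through `x ↦ -x`. -/
theorem integral_exp_mul_add_reflect {q : ℝ → ℝ} (hq : Integrable q) {k : ℝ} (hk : 0 < k) (a : ℝ) :
    (∫ x in Ioi a, Real.exp (-(2 * k * (x - a))) * q x) +
      ∫ x in Ioi (-a), Real.exp (-(2 * k * (x - -a))) * q (-x)
        = ∫ x, Real.exp (-(2 * k * |x - a|)) * q x := by
  have hi := integrable_exp_abs_mul hq hk a
  rw [← integral_add_compl (measurableSet_Ioi (a := a)) hi, compl_Ioi]
  congr 1
  · refine setIntegral_congr_fun measurableSet_Ioi fun x hx => ?_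
    have : a < x := hx
    rw [abs_of_pos (sub_pos.2 this)]
  · have := integral_comp_neg_Ioi (-a) fun x => Real.exp (-(2 * k * |x - a|)) * q x
    rw [neg_neg] at this
    rw [← this]
    refine setIntegral_congr_fun measurableSet_Ioi fun x hx => ?_
    have : -a < x := hx
    rw [abs_of_neg (by linarith), show -(-x - a) = x - -a by ring]

theorem exists_isBoundState {q : ℝ → ℝ} (hq : Integrable fun x : ℝ => (1 + |x|) * q x)
    (hτ : bargmannTau q < 1) (hneg : ∫ x, q x < 0) :
    ∃ (E : ℝ) (v : ℝ → ℝ), E < 0 ∧ IsBoundState q E v := by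
  have hq1 := integrable_of_weighted hq
  have hq1' : Integrable fun x => q (-x) := hq1.comp_neg
  obtain ⟨a, ha, ha'⟩ := exists_halfBargmann_lt_one hq hτ
  have hm : ∫⁻ x in Ici a, ENNReal.ofReal ((x - a) * max (-q x) 0) < 1 := by
    rwa [lintegral_eq_halfBargmann hq, ENNReal.ofReal_lt_one]
  have hm' : ∫⁻ x in Ici (-a), ENNReal.ofReal ((x - -a) * max (-q (-x)) 0) < 1 := by
    rwa [lintegral_eq_halfBargmann (q := fun x => q (-x)) (by simpa using hq.comp_neg),
      ENNReal.ofReal_lt_one]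
  obtain ⟨ε, hεneg, hε⟩ := (((tendsto_integral_exp_abs_mul hq1 a).eventually
    (gt_mem_nhds hneg)).and self_mem_nhdsWithin).exists
  have hε : 0 < ε := hε
  obtain ⟨h, d, H⟩ := exists_jostFamily hq1 hε
  obtain ⟨h', d', H'⟩ := exists_jostFamily hq1' hε
  have hpos : ∀ k ≥ ε, 0 < h k a := fun k hk =>
    H.pos_of_bargmann hq1 hk (hε.trans_le hk) hm le_rfl
  have hpos' : ∀ k ≥ ε, 0 < h' k (-a) := fun k hk =>
    H'.pos_of_bargmann hq1' hk (hε.trans_le hk) hm' le_rfl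
  -- With `f = e^{-kx} h(x)` and `g = e^{kx} h'(-x)`, this is the Wronskian `f' g - f g'` at `a`,
  -- where the exponentials cancel. Here `h'` and `d'` belong to the reflected potential.
  set Φ : ℝ → ℝ := fun k =>
    h k a * (d' k (-a) - k * h' k (-a)) + (d k a - k * h k a) * h' k (-a) with hΦ
  have hΦc : ContinuousOn Φ (Ici ε) :=
    ((H.continuousOn a).mul ((H'.continuousOn_deriv _).sub
      (continuousOn_id.mul (H'.continuousOn _)))).add
      (((H.continuousOn_deriv a).sub (continuousOn_id.mul (H.continuousOn a))).mul
        (H'.continuousOn _))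
  -- The Riccati bounds add up to `-(d/h + d'/h') ≤ ∫ e^{-2ε|x-a|} q`, which is below `-2ε` by the
  -- choice of `ε`.
  have hΦε : 0 ≤ Φ ε := by
    have h1 := H.neg_div_le_integral hq1 le_rfl hε (a := a) fun x hx =>
      H.pos_of_bargmann hq1 le_rfl hε hm hx
    have h2 := H'.neg_div_le_integral hq1' le_rfl hε (a := -a) fun x hx =>
      H'.pos_of_bargmann hq1' le_rfl hε hm' hx
    have h3 := integral_exp_mul_add_reflect hq1 hε a
    have p1 := hpos ε le_rfl
    have p2 := hpos' ε le_rfl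
    have e : Φ ε = h ε a * h' ε (-a) * (d ε a / h ε a + d' ε (-a) / h' ε (-a) - 2 * ε) := by
      simp only [hΦ]
      field_simp
      ring
    rw [e]
    exact mul_nonneg (mul_pos p1 p2).le (by linarith)
  obtain ⟨K₁, hK₁⟩ := H.exists_forall_large hq1
  obtain ⟨K₂, hK₂⟩ := H'.exists_forall_large hq1'
  set K := max ε (max K₁ K₂) with hK
  have hεK : ε ≤ K := le_max_left _ _
  have hΦK : Φ K ≤ 0 := by
    obtain ⟨p1, n1⟩ := hK₁ K ((le_max_left _ _).trans (le_max_right _ _)) hεK a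
    obtain ⟨p2, n2⟩ := hK₂ K ((le_max_right _ _).trans (le_max_right _ _)) hεK (-a)
    exact add_nonpos (mul_nonpos_of_nonneg_of_nonpos p1.le n2.le)
      (mul_nonpos_of_nonpos_of_nonneg n1.le p2.le)
  obtain ⟨k, ⟨hk, -⟩, hk0⟩ := intermediate_value_Icc' hεK (hΦc.mono Icc_subset_Ici_self) ⟨hΦK, hΦε⟩
  have hkpos : 0 < k := hε.trans_le hk
  set f : ℝ → ℝ := fun x => Real.exp (-(k * x)) * h k x with hf
  set g : ℝ → ℝ := fun x => Real.exp (-(k * -x)) * h' k (-x) with hg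
  have hfs : IsSolution q (-k ^ 2) f := H.isSolution hk
  have hgs : IsSolution q (-k ^ 2) g := by
    have := (H'.isSolution hk).comp_neg
    simp only [neg_neg] at this
    exact this
  have hfd := H.hasDerivAt_solution hk a
  have hgd : HasDerivAt g (-(Real.exp (-(k * -a)) * (d' k (-a) - k * h' k (-a)))) a := by
    simpa using! (H'.hasDerivAt_solution hk (-a)).comp a (hasDerivAt_neg a)
  have hga : 0 < g a := mul_pos (Real.exp_pos _) (hpos' k hk)
  have hfa : 0 < f a := mul_pos (Real.exp_pos _) (hpos k hk)
  -- This combination vanishes at `a` by construction, and its derivative there is a multiple of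
  -- `Φ(k) = 0`.
  have hz : ∀ x, g a * f x + -f a * g x = 0 := by
    refine (hfs.linear_comb hgs (g a) (-f a)).eq_zero_of_initial hq1 (a := a) (by ring) ?_
    have hd : HasDerivAt (fun x => g a * f x + -f a * g x) _ a :=
      (hfd.const_mul (g a)).add (hgd.const_mul (-f a))
    rw [hd.deriv]
    simp only [hΦ] at hk0
    simp only [hf, hg]
    linear_combination Real.exp (-(k * a)) * Real.exp (-(k * -a)) * hk0
  have hfg : ∀ x, f x = f a / g a * g x := fun x => by
    field_simp
    linear_combination hz x
  -- `f` is square integrable on the right by its own decay, and on the left as a multiple of `g`.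
  have hL : Integrable fun x => f x ^ 2 := by
    have h1 : IntegrableOn (fun x => f x ^ 2) (Ici 0) := H.integrableOn_sq hk hkpos 0
    have h2 : IntegrableOn (fun x => g x ^ 2) (Iic 0) :=
      integrableOn_Ici_comp_neg_iff.1 (by
        simpa [hg] using H'.integrableOn_sq hk hkpos 0)
    have h3 : IntegrableOn (fun x => f x ^ 2) (Iic 0) := by
      rw [show (fun x => f x ^ 2) = fun x => (f a / g a) ^ 2 * g x ^ 2 from
        funext fun x => by rw [hfg x, mul_pow]]
      exact h2.const_mul _
    rw [← integrableOn_univ, ← Iic_union_Ici (a := (0 : ℝ))]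
    exact h3.union h1
  refine ⟨-k ^ 2, f, neg_neg_of_pos (by positivity), fun h0 => hfa.ne' (congrFun h0 a),
    (memLp_two_iff_integrable_sq hfs.locallyAC.continuous.aestronglyMeasurable).2 hL,
    hfs.differentiable, hfs.absCont, ?_⟩
  filter_upwards [hfs.equation] with x hx
  rw [hx.deriv]
  ring

theorem mainTheorem3 (q : ℝ → ℝ)
    (hq : Integrable (fun x : ℝ => (1 + |x|) * q x) volume)
    (hτ : bargmannTau q < 1) :
    HasAtMostOneBoundState q ∧ ((∫ x : ℝ, q x) < 0 → HasExactlyOneBoundState q) := by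
  have hone := hasAtMostOneBoundState (integrable_of_weighted hq) hτ
  refine ⟨hone, fun hneg => ?_⟩
  obtain ⟨E, v, hE, hv⟩ := exists_isBoundState hq hτ hneg
  exact ⟨E, v, hE, hv, fun F w hw => hone E F v w hv hw⟩
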